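/- Let $b>1$, and let $Z=(Z(t))_{t\ge 0}$ be the Markov process on $(0,\infty)$ with càdlàg paths, started from $Z(0)=1$, with infinitesimal generator $$\mathcal{G}f(x)=-b\,x f'(x)+x\,(f(x+1)-f(x)),$$ in the sense that $f(Z(t))-\int_0^t \mathcal{G}f(Z(s))\,\mathrm{d}s$ is a martingale for every smooth compactly supported test function $f$. Then $Z$ is a subcritical continuous state branching process (that is, a continuous state branching process whose branching mechanism $\psi$ satisfies $\psi'(0+)>0$), $\lim_{t\to\infty}Z(t)=0$ almost surely, and $$\mathbb{E}\left(\exp\left(c\,b\int_0^\infty Z(s)\,\mathrm{d}s\right)\right)=b,\qquad\text{where } c=\ln b+\frac1b-1>0.$$ -/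

import Mathlib

open MeasureTheory ProbabilityTheory Filter Topology
open scoped NNReal ENNReal

/-- Right-continuous with left limits, for a real path indexed by `[0, ∞)`. -/
def IsCadlag (x : ℝ≥0 → ℝ) : Prop :=
  ∀ t : ℝ≥0, ContinuousWithinAt x (Set.Ici t) t ∧ ∃ l : ℝ, Tendsto x (𝓝[<] t) (𝓝 l)

/-- The operator `𝒢 f (x) = - b x f'(x) + x (f (x + 1) - f x)`. -/
noncomputable def genZ (b : ℝ) (f : ℝ → ℝ) (x : ℝ) : ℝ :=
  -b * x * deriv f x + x * (f (x + 1) - f x)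

/-- `Z` is a process on `(0, ∞)` with càdlàg paths, started from `1`, with infinitesimal generator
`genZ b`, in the sense of the martingale problem: for every smooth compactly supported test
function `f`, the process `f (Z t) - ∫₀ᵗ 𝒢 f (Z s) ds` is a martingale. (The process is adapted to
a given filtration `ℱ`, which may be its natural filtration.) -/
structure IsProcessZ {Ω : Type*} {m : MeasurableSpace Ω} (μ : Measure Ω) (ℱ : Filtration ℝ≥0 m)
    (b : ℝ) (Z : ℝ≥0 → Ω → ℝ) : Prop where
  adapted : ∀ t, Measurable[ℱ t] (Z t)
  pos : ∀ t ω, 0 < Z t ω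
  cadlag : ∀ ω, IsCadlag (fun t => Z t ω)
  init : ∀ᵐ ω ∂μ, Z 0 ω = 1
  martingale : ∀ f : ℝ → ℝ, ContDiff ℝ (⊤ : ℕ∞) f → HasCompactSupport f →
    Martingale
      (fun (t : ℝ≥0) ω => f (Z t ω) - ∫ s in (0 : ℝ)..(t : ℝ), genZ b f (Z s.toNNReal ω)) ℱ μ

/-- Branching mechanisms of (unkilled) continuous state branching
processes: the functions `ψ` of Lévy–Khintchine form
`ψ(q) = a q + σ q² + ∫_{(0,∞)} (exp(-q x) - 1 + q x 1_{x < 1}) ν(dx)` for `q ≥ 0`, where `σ ≥ 0` and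
`∫ min(1, x²) ν(dx) < ∞`. -/
def IsBranchingMechanism (ψ : ℝ → ℝ) : Prop :=
  ∃ (a σ : ℝ) (ν : Measure ℝ), 0 ≤ σ ∧ ν (Set.Iic 0) = 0 ∧
    ∫⁻ x, ENNReal.ofReal (min 1 (x ^ 2)) ∂ν < ∞ ∧
    ∀ q : ℝ, 0 ≤ q → ψ q = a * q + σ * q ^ 2 +
      ∫ x, (Real.exp (-q * x) - 1 + q * (Set.Iio (1 : ℝ)).indicator (fun y => y) x) ∂ν

/-- `Z` is a (finite) continuous state branching process with branching mechanism `ψ`: a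
nonnegative time-homogeneous Markov process with
`E[exp(-θ Z(s+t)) | ℱ_s] = exp(-u_t(θ) Z(s))`, where `∂u_t(θ)/∂t = -ψ(u_t(θ))` and `u_0(θ) = θ`. -/
def IsCSBP {Ω : Type*} {m : MeasurableSpace Ω} (μ : Measure Ω) (ℱ : Filtration ℝ≥0 m)
    (ψ : ℝ → ℝ) (Z : ℝ≥0 → Ω → ℝ) : Prop :=
  IsBranchingMechanism ψ ∧ (∀ t, Measurable[ℱ t] (Z t)) ∧ (∀ t ω, 0 ≤ Z t ω) ∧
  ∃ u : ℝ≥0 → ℝ → ℝ,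
    (∀ θ : ℝ, 0 < θ → u 0 θ = θ ∧ ∀ t : ℝ≥0, 0 ≤ u t θ ∧
      HasDerivWithinAt (fun r : ℝ => u r.toNNReal θ) (-ψ (u t θ)) (Set.Ici 0) (t : ℝ)) ∧
    ∀ θ : ℝ, 0 < θ → ∀ s t : ℝ≥0,
      μ[fun ω => Real.exp (-θ * Z (s + t) ω) | ℱ s]
        =ᵐ[μ] fun ω => Real.exp (-(u t θ) * Z s ω)

/-- `Z` is a subcritical continuous state branching process: its branching mechanism `ψ` satisfies
`0 < ψ'(0+)`, so that means decay like `exp(-ψ'(0+) t)`. -/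
def IsSubcriticalCSBP {Ω : Type*} {m : MeasurableSpace Ω} (μ : Measure Ω) (ℱ : Filtration ℝ≥0 m)
    (Z : ℝ≥0 → Ω → ℝ) : Prop :=
  ∃ (ψ : ℝ → ℝ) (ρ : ℝ), IsCSBP μ ℱ ψ Z ∧ HasDerivWithinAt ψ ρ (Set.Ici 0) 0 ∧ 0 < ρ

/-!
Write `ψ(q) = b q + exp(-q) - 1`, `κ(l) = -ψ(-l) = b l - exp l + 1`, so that
`𝒢 (exp(l ·)) (x) = -κ(l) x exp(l x)`. Everything is read off from the exponential functions, which
are not compactly supported; `IsProcessZ.integral_mul_martIncr` first extends the martingale problem,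
by cutting off and dominated convergence, to smooth functions with a limit at infinity.

*Branching.* Let `u` solve `u' = -ψ(u)`, `u 0 = θ > 0` (`exists_branchMech_flow`). The function
`r ↦ E[V exp(-u_{T-r}(θ) Z r)]`, with `V` bounded and measurable with respect to the past of `s`, is
continuous on `[s, T]` with zero right derivative, hence constant
(`IsProcessZ.integral_mul_exp_flow`). This is the branching property, with Lévy measure the unit mass
at `1`, and `ψ'(0) = b - 1 > 0`.

*Paths.* Since `u_t(θ) ≥ θ exp(-b t)`, letting `θ → ∞` in the Laplace transform shows that
`exp(b t) Z t` is almost surely nondecreasing (`IsProcessZ.ae_exp_mul_mono`). So paths are locally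
bounded, and `Z t ≤ exp(b) ∫_t^(t+1) Z`: the convergence `Z t → 0` follows from `∫₀^∞ Z < ∞`, without
a martingale convergence theorem.

*Exponential moments.* `M^l t = exp(l Z t + κ(l) ∫₀ᵗ Z)` is formally a martingale with mean `exp l`.
No localization by stopping times is used. Instead a Feynman–Kac formula with bounded data
(`IsProcessZ.feynmanKac`) is applied to `Φ(exp(l x))` with `Φ(y) = y / (1 + ε y)` and a bounded
potential; by concavity of `Φ` this is a supersolution with explicit defect (`genZ_satExp_add`).
Letting `ε → 0`, Fatou gives `E[M^l t] ≤ exp l` for `0 < l ≤ log b`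
(`IsProcessZ.lintegral_exp_le`), and for `l < log b` the defect is dominated by `M^{log b}`, so that
equality holds (`IsProcessZ.integral_exp_eq`).

*The critical exponent.* `κ` is maximal at `log b`, where `κ(log b) = c b`. Fatou as `t → ∞` gives
`∫₀^∞ Z < ∞` and `E[exp(c b ∫₀^∞ Z)] ≤ b`. For `l < log b` the part of `M^l t` on `{Z t > K}` has mean at
most `exp(-(log b - l) K) b`, so `M^l` loses no mass as `t → ∞` and
`exp l ≤ E[exp(κ(l) ∫₀^∞ Z)] ≤ E[exp(c b ∫₀^∞ Z)]`; then `l` increases to `log b`.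
-/

/-! ### The branching mechanism and its flow -/

/-- The branching mechanism `ψ(q) = b q + exp(-q) - 1`: the function with
`𝒢 (exp(-q ·)) (x) = x ψ(q) exp(-q x)`. -/
noncomputable def branchMech (b q : ℝ) : ℝ := b * q + Real.exp (-q) - 1

lemma hasDerivAt_branchMech (b q : ℝ) :
    HasDerivAt (branchMech b) (b - Real.exp (-q)) q := by
  have h := (((hasDerivAt_id q).const_mul b).add ((hasDerivAt_id q).neg.exp)).sub_const 1
  exact h.congr_deriv (by simp [sub_eq_add_neg])

lemma branchMech_nonneg {b q : ℝ} (hb : 1 < b) (hq : 0 ≤ q) : 0 ≤ branchMech b q := by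
  have h1 := Real.add_one_le_exp (-q)
  unfold branchMech
  nlinarith

lemma branchMech_lt {b q : ℝ} (hq : 0 < q) : branchMech b q < b * q := by
  have h1 : Real.exp (-q) < 1 := by simpa using hq
  unfold branchMech
  linarith

lemma branchMech_lipschitzOnWith {b : ℝ} (hb : 1 < b) :
    LipschitzOnWith b.toNNReal (branchMech b) (Set.Ici 0) := by
  refine Convex.lipschitzOnWith_of_nnnorm_hasDerivWithin_le (convex_Ici 0)
    (fun q _ => (hasDerivAt_branchMech b q).hasDerivWithinAt) fun q hq => ?_
  have h1 : Real.exp (-q) ≤ 1 := by simpa using hq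
  have h2 := Real.exp_pos (-q)
  rw [← NNReal.coe_le_coe, coe_nnnorm, Real.norm_eq_abs, Real.coe_toNNReal b (by linarith), abs_le]
  constructor <;> linarith

lemma isBranchingMechanism_branchMech (b : ℝ) : IsBranchingMechanism (branchMech b) := by
  refine ⟨b, 0, Measure.dirac 1, le_rfl, ?_, ?_, fun q _ => ?_⟩
  · simp
  · simp
  · simp [branchMech]; ring

/-- A bounded Lipschitz vector field on the line has forward solutions for all times. -/
lemma exists_forward_solution {v : ℝ → ℝ} {K L : ℝ≥0} (hv : LipschitzWith K v)
    (hL : ∀ x, |v x| ≤ L) (x₀ : ℝ) :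
    ∃ u : ℝ → ℝ, u 0 = x₀ ∧ ∀ t, 0 ≤ t → HasDerivWithinAt u (v (u t)) (Set.Ici 0) t := by
  have key : ∀ n : ℕ, ∃ α : ℝ → ℝ, α 0 = x₀ ∧
      ∀ t ∈ Set.Icc (0 : ℝ) n, HasDerivWithinAt α (v (α t)) (Set.Icc 0 (n : ℝ)) t := by
    intro n
    have hpl : IsPicardLindelof (fun _ => v) (⟨0, by simp⟩ : Set.Icc (0 : ℝ) n) x₀
        (L * n) 0 L K :=
      { lipschitzOnWith := fun _ _ => hv.lipschitzOnWith
        continuousOn := fun _ _ => continuousOn_const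
        norm_le := fun _ _ x _ => hL x
        mul_max_le := by simp }
    exact hpl.exists_eq_forall_mem_Icc_hasDerivWithinAt (by simp)
  choose α h0 hα using key
  have hcont : ∀ n, ContinuousOn (α n) (Set.Icc 0 (n : ℝ)) :=
    fun n t ht => (hα n t ht).continuousWithinAt
  have hright : ∀ n : ℕ, ∀ t ∈ Set.Ico (0 : ℝ) n, HasDerivWithinAt (α n) (v (α n t)) (Set.Ici t) t := by
    intro n t ht
    refine ((hα n t ⟨ht.1, ht.2.le⟩).mono_of_mem_nhdsWithin ?_)
    filter_upwards [self_mem_nhdsWithin, mem_nhdsWithin_of_mem_nhds (Iio_mem_nhds ht.2)] with r h1 h2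
    exact ⟨ht.1.trans h1, le_of_lt h2⟩
  have heq : ∀ n m : ℕ, n ≤ m → Set.EqOn (α n) (α m) (Set.Icc 0 (n : ℝ)) := by
    intro n m hnm
    have hnm' : (n : ℝ) ≤ m := by exact_mod_cast hnm
    exact ODE_solution_unique (v := fun _ => v) (fun _ => hv) (hcont n) (hright n)
      ((hcont m).mono (Set.Icc_subset_Icc_right hnm'))
      (fun t ht => hright m t ⟨ht.1, ht.2.trans_le hnm'⟩) ((h0 n).trans (h0 m).symm)
  refine ⟨fun t => α (⌊t⌋₊ + 1) t, h0 _, fun t ht => ?_⟩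
  set N := ⌊t⌋₊ + 2 with hN
  have hagree : ∀ r ∈ Set.Icc (0 : ℝ) t ∪ Set.Ico t N, α (⌊r⌋₊ + 1) r = α N r := by
    intro r hr
    have hr0 : 0 ≤ r := by rcases hr with hr | hr; exacts [hr.1, ht.trans hr.1]
    have hrN : r < N := by
      rcases hr with hr | hr
      · have := Nat.lt_floor_add_one t
        have h2 := hr.2
        rw [hN]; push_cast; linarith
      · exact hr.2
    refine heq _ _ ?_ ⟨hr0, ?_⟩
    · have := (Nat.floor_lt hr0).2 hrN
      omega
    · push_cast; exact (Nat.lt_floor_add_one r).le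
  have htN : t < N := by
    have := Nat.lt_floor_add_one t
    rw [hN]; push_cast; linarith
  have hmem : Set.Icc (0 : ℝ) t ∪ Set.Ico t N ∈ 𝓝[Set.Ici 0] t := by
    filter_upwards [self_mem_nhdsWithin, mem_nhdsWithin_of_mem_nhds (Iio_mem_nhds htN)] with r h1 h2
    rcases le_total r t with h | h
    · exact Or.inl ⟨h1, h⟩
    · exact Or.inr ⟨h, h2⟩
  have h1 : HasDerivWithinAt (α N) (v (α N t)) (Set.Ici 0) t := by
    refine (hα N t ⟨ht, htN.le⟩).mono_of_mem_nhdsWithin ?_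
    filter_upwards [self_mem_nhdsWithin, mem_nhdsWithin_of_mem_nhds (Iio_mem_nhds htN)] with r h1 h2
    exact ⟨h1, le_of_lt h2⟩
  have ht' : α (⌊t⌋₊ + 1) t = α N t := hagree t (Or.inl ⟨ht, le_rfl⟩)
  simp only [ht']
  refine h1.congr_of_eventuallyEq ?_ ht'
  filter_upwards [hmem] with r hr using hagree r hr

/-- The flow of `-ψ` from `θ > 0` exists for all times and decays no faster than `exp(-b t)`,
because `ψ(q) < b q` for `q > 0`. -/
lemma exists_branchMech_flow {b θ : ℝ} (hb : 1 < b) (hθ : 0 < θ) :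
    ∃ u : ℝ → ℝ, u 0 = θ ∧ ∀ t, 0 ≤ t → θ * Real.exp (-b * t) ≤ u t ∧ u t ≤ θ ∧
      HasDerivWithinAt u (-branchMech b (u t)) (Set.Ici 0) t := by
  -- `ψ` is made bounded by freezing it outside `[0, θ]`, an interval the solution never leaves.
  set p : ℝ → ℝ := fun q => max 0 (min q θ) with hp
  have hpmem : ∀ q, p q ∈ Set.Icc 0 θ := fun q =>
    ⟨le_max_left _ _, max_le hθ.le (min_le_right _ _)⟩
  have hpid : ∀ q ∈ Set.Icc 0 θ, p q = q := fun q hq => by simp [hp, hq.1, hq.2]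
  have hplip : LipschitzWith 1 p := by
    have h1 : LipschitzWith 1 (fun q : ℝ => min q θ) := LipschitzWith.id.min_const θ
    exact h1.const_max 0
  have hlip : LipschitzWith (b.toNNReal * 1) (fun q => -branchMech b (p q)) := by
    have := (branchMech_lipschitzOnWith hb).comp hplip.lipschitzOnWith
      (s := Set.univ) (fun q _ => (hpmem q).1)
    exact (lipschitzOnWith_univ.1 this).neg
  have hbound : ∀ q, |-branchMech b (p q)| ≤ ((b * θ).toNNReal : ℝ) := by
    intro q
    rw [abs_neg, abs_of_nonneg (branchMech_nonneg hb (hpmem q).1),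
      Real.coe_toNNReal _ (by positivity)]
    rcases (hpmem q).1.eq_or_lt with h | h
    · rw [← h]; simp [branchMech]; positivity
    · exact (branchMech_lt h).le.trans (mul_le_mul_of_nonneg_left (hpmem q).2 (by linarith))
  obtain ⟨u, hu0, hu⟩ := exists_forward_solution hlip hbound θ
  have hcont : ContinuousOn u (Set.Ici 0) := fun t ht => (hu t ht).continuousWithinAt
  have hle : ∀ t, 0 ≤ t → u t ≤ θ := by
    have hanti : AntitoneOn u (Set.Ici 0) := by
      refine antitoneOn_of_deriv_nonpos (convex_Ici 0) hcont ?_ ?_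
      · intro t ht
        rw [interior_Ici] at ht
        exact ((hu t (le_of_lt ht)).hasDerivAt (Ici_mem_nhds ht)).differentiableAt.differentiableWithinAt
      · intro t ht
        rw [interior_Ici] at ht
        rw [((hu t (le_of_lt ht)).hasDerivAt (Ici_mem_nhds ht)).deriv]
        have := branchMech_nonneg hb (hpmem (u t)).1
        linarith
    intro t ht
    rw [← hu0]
    exact hanti (Set.mem_Ici.2 le_rfl) ht ht
  have hge : ∀ t, 0 ≤ t → θ * Real.exp (-b * t) ≤ u t := by
    intro t ht
    have hB : ∀ x, HasDerivAt (fun x => -(θ * Real.exp (-b * x))) (b * (θ * Real.exp (-b * x))) x := by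
      intro x
      have := (((hasDerivAt_id x).const_mul (-b)).exp.const_mul θ).neg
      exact this.congr_deriv (by simp; ring)
    have := image_le_of_deriv_right_lt_deriv_boundary (f := fun x => -u x)
      (f' := fun x => branchMech b (p (u x))) (a := 0) (b := t)
      ((hcont.mono Set.Icc_subset_Ici_self).neg)
      (fun x hx => by
        have := ((hu x hx.1).mono (Set.Ici_subset_Ici.2 hx.1)).neg
        rw [neg_neg] at this
        exact this)
      (B := fun x => -(θ * Real.exp (-b * x))) (B' := fun x => b * (θ * Real.exp (-b * x)))
      (by simp [hu0]) hB
      (fun x hx hxe => by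
        have hux : u x = θ * Real.exp (-b * x) := neg_injective hxe
        have hpos : 0 < u x := by rw [hux]; positivity
        rw [hpid _ ⟨hpos.le, hle x hx.1⟩, ← hux]
        exact branchMech_lt hpos)
      (Set.right_mem_Icc.2 ht)
    linarith
  refine ⟨u, hu0, fun t ht => ⟨hge t ht, hle t ht, ?_⟩⟩
  have h := hu t ht
  rwa [hpid _ ⟨le_trans (by positivity) (hge t ht), hle t ht⟩] at h

/-! ### Measurability along right-continuous paths -/

lemma measurable_uncurry_of_rightCont {Ω : Type*} {m : MeasurableSpace Ω} {W : ℝ → Ω → ℝ}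
    (hW : ∀ s, Measurable (W s))
    (hc : ∀ ω s, ContinuousWithinAt (fun r => W r ω) (Set.Ici s) s) :
    Measurable (Function.uncurry W) := by
  -- `⌈(n + 1) s⌉ / (n + 1)` takes countably many values and tends to `s` from the right.
  refine measurable_of_tendsto_metrizable
    (f := fun (n : ℕ) (p : ℝ × Ω) => W ((⌈((n : ℝ) + 1) * p.1⌉ : ℤ) / ((n : ℝ) + 1)) p.2) ?_ ?_
  · intro n
    have h1 : Measurable (fun q : ℤ × Ω => W ((q.1 : ℝ) / ((n : ℝ) + 1)) q.2) :=
      measurable_from_prod_countable_right fun k => hW ((k : ℝ) / ((n : ℝ) + 1))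
    exact h1.comp ((Int.measurable_ceil.comp (measurable_fst.const_mul _)).prodMk measurable_snd)
  · rw [tendsto_pi_nhds]
    rintro ⟨s, ω⟩
    refine (hc ω s).tendsto.comp (tendsto_nhdsWithin_iff.2 ⟨?_, Eventually.of_forall fun n => ?_⟩)
    · have hlim : Tendsto (fun n : ℕ => s + 1 / ((n : ℝ) + 1)) atTop (𝓝 (s + 0)) :=
        tendsto_const_nhds.add tendsto_one_div_add_atTop_nhds_zero_nat
      rw [add_zero] at hlim
      refine tendsto_of_tendsto_of_tendsto_of_le_of_le tendsto_const_nhds hlim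
        (fun n => ?_) (fun n => ?_)
      · have hn : (0 : ℝ) < (n : ℝ) + 1 := by positivity
        rw [le_div_iff₀ hn, mul_comm]
        exact Int.le_ceil _
      · have hn : (0 : ℝ) < (n : ℝ) + 1 := by positivity
        rw [div_le_iff₀ hn, add_mul s, one_div, inv_mul_cancel₀ hn.ne', mul_comm s]
        exact (Int.ceil_lt_add_one _).le
    · have hn : (0 : ℝ) < (n : ℝ) + 1 := by positivity
      rw [Set.mem_Ici, le_div_iff₀ hn, mul_comm]
      exact Int.le_ceil _

lemma measurable_intervalIntegral_path {Ω : Type*} {m : MeasurableSpace Ω} {W : ℝ → Ω → ℝ}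
    (hW : ∀ s, Measurable (W s))
    (hc : ∀ ω s, ContinuousWithinAt (fun r => W r ω) (Set.Ici s) s) {k : ℝ → ℝ}
    (hk : Measurable k) (s t : ℝ) :
    Measurable (fun ω => ∫ r in s..t, k (W r ω)) := by
  have h1 : StronglyMeasurable (Function.uncurry fun ω r => k (W r ω)) :=
    (hk.comp ((measurable_uncurry_of_rightCont hW hc).comp measurable_swap)).stronglyMeasurable
  simp only [intervalIntegral]
  exact (h1.integral_prod_right.sub h1.integral_prod_right).measurable

lemma intervalIntegrable_of_measurable_of_abs_le {f : ℝ → ℝ} (hf : Measurable f) {C : ℝ}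
    (h : ∀ x, |f x| ≤ C) (s t : ℝ) : IntervalIntegrable f volume s t :=
  (intervalIntegrable_const (c := C)).mono_fun hf.aestronglyMeasurable
    (Eventually.of_forall fun x => (h x).trans (le_abs_self C))

lemma integrable_of_measurable_of_abs_le {Ω : Type*} {m : MeasurableSpace Ω} {μ : Measure Ω}
    [IsFiniteMeasure μ] {f : Ω → ℝ} (hf : Measurable f) {C : ℝ} (h : ∀ x, |f x| ≤ C) :
    Integrable f μ :=
  Integrable.of_bound hf.aestronglyMeasurable C (Eventually.of_forall h)

lemma abs_intervalIntegral_le {f : ℝ → ℝ} {C : ℝ} (h : ∀ x, |f x| ≤ C) {s t : ℝ} (hst : s ≤ t) :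
    |∫ r in s..t, f r| ≤ C * (t - s) := by
  have := intervalIntegral.norm_integral_le_of_norm_le_const (a := s) (b := t) (f := f) (C := C)
    (fun x _ => h x)
  rwa [abs_of_nonneg (sub_nonneg.2 hst)] at this

namespace IsProcessZ

variable {Ω : Type*} {m : MeasurableSpace Ω} {μ : Measure Ω} {ℱ : Filtration ℝ≥0 m} {b : ℝ}
  {Z : ℝ≥0 → Ω → ℝ}

lemma rightCont_comp (hZ : IsProcessZ μ ℱ b Z) {τ : ℝ → ℝ≥0} (hτ : Continuous τ)
    (hmono : Monotone τ) (ω : Ω) (s : ℝ) :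
    ContinuousWithinAt (fun r => Z (τ r) ω) (Set.Ici s) s :=
  ContinuousWithinAt.comp (t := Set.Ici (τ s)) (hZ.cadlag ω (τ s)).1 hτ.continuousWithinAt
    (fun _ hr => hmono hr)

lemma rightCont (hZ : IsProcessZ μ ℱ b Z) (ω : Ω) (s : ℝ) :
    ContinuousWithinAt (fun r : ℝ => Z r.toNNReal ω) (Set.Ici s) s :=
  hZ.rightCont_comp continuous_real_toNNReal (fun _ _ h => Real.toNNReal_mono h) ω s

lemma measurable (hZ : IsProcessZ μ ℱ b Z) (t : ℝ≥0) : Measurable (Z t) :=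
  (hZ.adapted t).mono (ℱ.le t) le_rfl

lemma measurable_uncurry (hZ : IsProcessZ μ ℱ b Z) :
    Measurable (fun p : ℝ × Ω => Z p.1.toNNReal p.2) :=
  measurable_uncurry_of_rightCont (W := fun s ω => Z s.toNNReal ω) (fun _ => hZ.measurable _)
    hZ.rightCont

lemma measurable_path (hZ : IsProcessZ μ ℱ b Z) (ω : Ω) :
    Measurable (fun s : ℝ => Z s.toNNReal ω) :=
  hZ.measurable_uncurry.comp measurable_prodMk_right

/-- Additive functionals of the path up to time `t` are `ℱ t`-measurable. -/
lemma adapted_integral (hZ : IsProcessZ μ ℱ b Z) {k : ℝ → ℝ} (hk : Measurable k) {t : ℝ}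
    (ht : 0 ≤ t) :
    Measurable[ℱ t.toNNReal] (fun ω => ∫ r in (0 : ℝ)..t, k (Z r.toNNReal ω)) := by
  have h := @measurable_intervalIntegral_path Ω (ℱ t.toNNReal)
    (fun r ω => Z (min r.toNNReal t.toNNReal) ω)
    (fun s => (hZ.adapted _).mono (ℱ.mono (min_le_right _ _)) le_rfl)
    (fun ω s => hZ.rightCont_comp (τ := fun r => min r.toNNReal t.toNNReal)
      (continuous_real_toNNReal.min continuous_const)
      (fun _ _ h => min_le_min_right _ (Real.toNNReal_mono h)) ω s) k hk 0 t
  convert h using 2 with ω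
  refine intervalIntegral.integral_congr fun r hr => ?_
  rw [Set.uIcc_of_le ht] at hr
  simp only [min_eq_left (Real.toNNReal_mono hr.2)]

lemma measurable_integral (hZ : IsProcessZ μ ℱ b Z) {k : ℝ → ℝ} (hk : Measurable k) (s t : ℝ) :
    Measurable (fun ω => ∫ r in s..t, k (Z r.toNNReal ω)) :=
  measurable_intervalIntegral_path (W := fun s ω => Z s.toNNReal ω) (fun _ => hZ.measurable _)
    hZ.rightCont hk s t

end IsProcessZ

/-! ### Enlarging the class of test functions -/

/-- Smooth functions on the line which, on `[0, ∞)`, approach a constant at rate `1 / (1 + x)`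
together with their derivative. The generator maps these to bounded functions, and the martingale
problem extends to them. -/
structure IsTest (f : ℝ → ℝ) : Prop where
  contDiff : ContDiff ℝ (⊤ : ℕ∞) f
  bound : ∃ a C : ℝ, ∀ x, 0 ≤ x → (1 + x) * |f x - a| ≤ C ∧ (1 + x) * |deriv f x| ≤ C

lemma genZ_bound {b a C : ℝ} {f : ℝ → ℝ}
    (h : ∀ x, 0 ≤ x → (1 + x) * |f x - a| ≤ C ∧ (1 + x) * |deriv f x| ≤ C) {x : ℝ} (hx : 0 ≤ x) :
    |genZ b f x| ≤ (|b| + 2) * C := by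
  obtain ⟨h1, h2⟩ := h x hx
  obtain ⟨h3, -⟩ := h (x + 1) (by linarith)
  have e1 : |genZ b f x| ≤ |b| * (x * |deriv f x|) + (x * |f (x + 1) - a| + x * |f x - a|) := by
    have : genZ b f x = -b * (x * deriv f x) + (x * (f (x + 1) - a) - x * (f x - a)) := by
      unfold genZ; ring
    rw [this]
    refine (abs_add_le _ _).trans (add_le_add ?_ ((abs_sub _ _).trans ?_))
    · rw [abs_mul, abs_mul, abs_neg, abs_of_nonneg hx]
    · rw [abs_mul, abs_mul, abs_of_nonneg hx]
  have a1 := abs_nonneg (f x - a)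
  have a2 := abs_nonneg (f (x + 1) - a)
  have a3 := abs_nonneg (deriv f x)
  have a4 : |b| * (x * |deriv f x|) ≤ |b| * C :=
    mul_le_mul_of_nonneg_left (by nlinarith) (abs_nonneg b)
  nlinarith

lemma continuous_genZ {f : ℝ → ℝ} (hf : ContDiff ℝ (⊤ : ℕ∞) f) (b : ℝ) : Continuous (genZ b f) := by
  have h1 : Continuous (deriv f) := hf.continuous_deriv (by simp)
  have h2 := hf.continuous
  unfold genZ
  fun_prop

namespace IsTest

variable {f : ℝ → ℝ}

lemma exists_bound (hf : IsTest f) (b : ℝ) :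
    ∃ C, ∀ x, 0 ≤ x → |f x| ≤ C ∧ |genZ b f x| ≤ C := by
  obtain ⟨a, C, h⟩ := hf.bound
  refine ⟨max (|a| + C) ((|b| + 2) * C), fun x hx => ⟨le_max_of_le_left ?_, le_max_of_le_right (genZ_bound h hx)⟩⟩
  have h1 := (h x hx).1
  have h2 := abs_nonneg (f x - a)
  have h3 : |f x| ≤ |a| + |f x - a| := by
    have := abs_add_le a (f x - a)
    rwa [add_sub_cancel] at this
  nlinarith

lemma of_hasCompactSupport (hf : ContDiff ℝ (⊤ : ℕ∞) f) (hs : HasCompactSupport f) : IsTest f := by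
  have h1 : Continuous (deriv f) := hf.continuous_deriv (by simp)
  have h2 := hf.continuous
  obtain ⟨C₁, hC₁⟩ := ((by fun_prop : Continuous fun x => (1 + x) * f x)).bounded_above_of_compact_support
    hs.mul_left
  obtain ⟨C₂, hC₂⟩ := ((by fun_prop : Continuous fun x => (1 + x) * deriv f x)).bounded_above_of_compact_support
    hs.deriv.mul_left
  refine ⟨hf, 0, max C₁ C₂, fun x hx => ⟨le_max_of_le_left ?_, le_max_of_le_right ?_⟩⟩
  · have := hC₁ x
    rwa [Real.norm_eq_abs, abs_mul, abs_of_nonneg (by linarith : 0 ≤ 1 + x), ← sub_zero (f x)] at this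
  · have := hC₂ x
    rwa [Real.norm_eq_abs, abs_mul, abs_of_nonneg (by linarith : 0 ≤ 1 + x)] at this

/-- Cutting off a test function (minus its limit) far away: the truncations have compact support,
satisfy the same bound with uniform constants, and agree with the function on any given bounded
interval from some index on. -/
lemma exists_cutoff (hf : IsTest f) (b : ℝ) :
    ∃ (a C : ℝ) (g : ℕ → ℝ → ℝ), (∀ n, ContDiff ℝ (⊤ : ℕ∞) (g n)) ∧
      (∀ n, HasCompactSupport (g n)) ∧
      (∀ n x, 0 ≤ x → |g n x| ≤ C ∧ |genZ b (g n) x| ≤ C) ∧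
      ∀ x, 0 ≤ x → ∀ᶠ n in atTop, g n x = f x - a ∧ genZ b (g n) x = genZ b f x := by
  obtain ⟨a, C, h⟩ := hf.bound
  let χ : ContDiffBump (0 : ℝ) := ⟨1, 2, one_pos, one_lt_two⟩
  have hχ : ContDiff ℝ (⊤ : ℕ∞) χ := χ.contDiff
  obtain ⟨D, hD⟩ := (hχ.continuous_deriv (by simp)).bounded_above_of_compact_support
    χ.hasCompactSupport.deriv
  have hD0 : 0 ≤ D := (norm_nonneg _).trans (hD 0)
  have hC0 : 0 ≤ C := le_trans (by positivity) (h 0 le_rfl).1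
  set g : ℕ → ℝ → ℝ := fun n x => (f x - a) * χ (x / ((n : ℝ) + 1)) with hg
  have hbound : ∀ n x, 0 ≤ x →
      (1 + x) * |g n x - 0| ≤ C + C * D ∧ (1 + x) * |deriv (g n) x| ≤ C + C * D := by
    intro n x hx
    obtain ⟨h1, h2⟩ := h x hx
    have hn : (1 : ℝ) ≤ (n : ℝ) + 1 := by simp
    have hχ1 : |χ (x / ((n : ℝ) + 1))| ≤ 1 := by
      rw [abs_of_nonneg χ.nonneg]; exact χ.le_one
    have hd : HasDerivAt (g n) (deriv f x * χ (x / ((n : ℝ) + 1)) +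
        (f x - a) * (deriv χ (x / ((n : ℝ) + 1)) * (1 / ((n : ℝ) + 1)))) x := by
      have e1 : HasDerivAt f (deriv f x) x :=
        (hf.contDiff.differentiable (by simp) x).hasDerivAt
      have e2 : HasDerivAt χ (deriv χ (x / ((n : ℝ) + 1))) (x / ((n : ℝ) + 1)) :=
        (hχ.differentiable (by simp) _).hasDerivAt
      have e3 : HasDerivAt (fun y : ℝ => y / ((n : ℝ) + 1)) (1 / ((n : ℝ) + 1)) x :=
        (hasDerivAt_id x).div_const _
      exact (e1.sub_const a).mul (HasDerivAt.comp (h₂ := (χ : ℝ → ℝ)) x e2 e3)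
    have hx1 : 0 ≤ 1 + x := by linarith
    constructor
    · rw [sub_zero, hg, abs_mul, ← mul_assoc]
      have := mul_le_mul h1 hχ1 (abs_nonneg _) hC0
      have : 0 ≤ C * D := by positivity
      linarith
    · rw [hd.deriv]
      have e1 : |deriv χ (x / ((n : ℝ) + 1)) * (1 / ((n : ℝ) + 1))| ≤ D := by
        rw [abs_mul]
        have : |1 / ((n : ℝ) + 1)| ≤ 1 := by
          rw [abs_of_nonneg (by positivity)]
          exact (div_le_one (by linarith)).2 hn
        have := mul_le_mul (hD (x / ((n : ℝ) + 1))) this (abs_nonneg _) hD0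
        rwa [mul_one] at this
      calc _ ≤ (1 + x) * (|deriv f x| * |χ (x / ((n : ℝ) + 1))| + |f x - a| *
              |deriv χ (x / ((n : ℝ) + 1)) * (1 / ((n : ℝ) + 1))|) := by
            rw [← abs_mul, ← abs_mul]
            exact mul_le_mul_of_nonneg_left (abs_add_le _ _) hx1
        _ = ((1 + x) * |deriv f x|) * |χ (x / ((n : ℝ) + 1))| + ((1 + x) * |f x - a|) *
              |deriv χ (x / ((n : ℝ) + 1)) * (1 / ((n : ℝ) + 1))| := by ring
        _ ≤ C * 1 + C * D := add_le_add (mul_le_mul h2 hχ1 (abs_nonneg _) hC0)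
              (mul_le_mul h1 e1 (abs_nonneg _) hC0)
        _ = C + C * D := by ring
  have heq : ∀ n : ℕ, ∀ x, 0 ≤ x → x < (n : ℝ) + 1 → g n =ᶠ[𝓝 x] fun y => f y - a := by
    intro n x hx hxn
    have hn : (0 : ℝ) < (n : ℝ) + 1 := by positivity
    filter_upwards [Ioo_mem_nhds (by linarith : -((n : ℝ) + 1) < x) hxn] with y hy
    have : χ (y / ((n : ℝ) + 1)) = 1 := by
      apply χ.one_of_mem_closedBall
      rw [mem_closedBall_zero_iff, Real.norm_eq_abs, abs_div, abs_of_pos hn, div_le_one hn, abs_le]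
      exact ⟨hy.1.le, hy.2.le⟩
    simp [hg, this]
  refine ⟨a, (1 + (|b| + 2)) * (C + C * D), g, fun n => ?_, fun n => ?_, fun n x hx => ⟨?_, ?_⟩,
    fun x hx => ?_⟩
  · exact (hf.contDiff.sub contDiff_const).mul (hχ.comp (contDiff_id.div_const _))
  · have hn : (0 : ℝ) < (n : ℝ) + 1 := by positivity
    refine HasCompactSupport.intro (isCompact_closedBall (0 : ℝ) (2 * ((n : ℝ) + 1))) fun x hx => ?_
    have : χ (x / ((n : ℝ) + 1)) = 0 := by
      apply χ.zero_of_le_dist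
      rw [mem_closedBall_zero_iff, not_le] at hx
      rw [dist_zero_right, norm_div, Real.norm_eq_abs ((n : ℝ) + 1), abs_of_pos hn, le_div_iff₀ hn]
      exact hx.le
    simp [hg, this]
  · have h1 := (hbound n x hx).1
    rw [sub_zero] at h1
    have h2 : 0 ≤ x * |g n x| := by positivity
    have h3 : 0 ≤ (|b| + 2) * (C + C * D) := by positivity
    nlinarith
  · refine (genZ_bound (hbound n) hx).trans ?_
    have : 0 ≤ C + C * D := by positivity
    nlinarith
  · filter_upwards [eventually_ge_atTop ⌈x + 1⌉₊] with n hn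
    have hxn : x + 1 < (n : ℝ) + 1 := by
      have := (Nat.le_ceil (x + 1)).trans (Nat.cast_le.2 hn)
      linarith
    have e1 := heq n x hx (by linarith)
    have e2 := heq n (x + 1) (by linarith) hxn
    refine ⟨e1.self_of_nhds, ?_⟩
    unfold genZ
    rw [e1.deriv_eq, e1.self_of_nhds, e2.self_of_nhds, deriv_sub_const]
    ring

end IsTest

/-! ### The martingale problem for the enlarged class of test functions -/

namespace IsProcessZ

variable {Ω : Type*} {m : MeasurableSpace Ω} {μ : Measure Ω} {ℱ : Filtration ℝ≥0 m} {b : ℝ}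
  {Z : ℝ≥0 → Ω → ℝ}

/-- The increment over `[s, t]` of the process `f (Z t) - ∫₀ᵗ 𝒢 f (Z r) dr`. -/
noncomputable def martIncr (b : ℝ) (f : ℝ → ℝ) (Z : ℝ≥0 → Ω → ℝ) (s t : ℝ) (ω : Ω) : ℝ :=
  f (Z t.toNNReal ω) - f (Z s.toNNReal ω) - ∫ r in s..t, genZ b f (Z r.toNNReal ω)

lemma measurable_martIncr (hZ : IsProcessZ μ ℱ b Z) {f : ℝ → ℝ} (hf : ContDiff ℝ (⊤ : ℕ∞) f)
    (s t : ℝ) : Measurable (martIncr b f Z s t) :=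
  ((hf.continuous.measurable.comp (hZ.measurable _)).sub
    (hf.continuous.measurable.comp (hZ.measurable _))).sub
    (hZ.measurable_integral (continuous_genZ hf b).measurable s t)

lemma abs_martIncr_le (hZ : IsProcessZ μ ℱ b Z) {f : ℝ → ℝ} {C : ℝ}
    (h : ∀ x, 0 ≤ x → |f x| ≤ C ∧ |genZ b f x| ≤ C) {s t : ℝ} (hst : s ≤ t) (ω : Ω) :
    |martIncr b f Z s t ω| ≤ 2 * C + C * (t - s) := by
  unfold martIncr
  refine (abs_sub _ _).trans (add_le_add ((abs_sub _ _).trans ?_)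
    (abs_intervalIntegral_le (fun r => (h _ (hZ.pos _ ω).le).2) hst))
  have h1 := (h _ (hZ.pos t.toNNReal ω).le).1
  have h2 := (h _ (hZ.pos s.toNNReal ω).le).1
  linarith

lemma integral_mul_martIncr_of_hasCompactSupport [IsProbabilityMeasure μ]
    (hZ : IsProcessZ μ ℱ b Z) {f : ℝ → ℝ}
    (hf : ContDiff ℝ (⊤ : ℕ∞) f) (hs : HasCompactSupport f) {s t : ℝ} (h0 : 0 ≤ s) (hst : s ≤ t)
    {V : Ω → ℝ} (hV : Measurable[ℱ s.toNNReal] V) {B : ℝ} (hB : ∀ ω, |V ω| ≤ B) :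
    ∫ ω, V ω * martIncr b f Z s t ω ∂μ = 0 := by
  obtain ⟨C, hC⟩ := (IsTest.of_hasCompactSupport hf hs).exists_bound b
  set M : ℝ≥0 → Ω → ℝ :=
    fun t ω => f (Z t ω) - ∫ s in (0 : ℝ)..(t : ℝ), genZ b f (Z s.toNNReal ω) with hM
  have hmart : Martingale M ℱ μ := hZ.martingale f hf hs
  have hle : s.toNNReal ≤ t.toNNReal := Real.toNNReal_mono hst
  have hVm : Measurable V := hV.mono (ℱ.le _) le_rfl
  have hVint : ∀ r, Integrable (V * M r) μ := fun r =>
    (hmart.integrable r).bdd_mul hVm.aestronglyMeasurable (Eventually.of_forall hB)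
  have hincr : ∀ ω, V ω * martIncr b f Z s t ω = (V * M t.toNNReal) ω - (V * M s.toNNReal) ω := by
    intro ω
    have hint : ∀ r q, IntervalIntegrable (fun s : ℝ => genZ b f (Z s.toNNReal ω)) volume r q :=
      intervalIntegrable_of_measurable_of_abs_le
        ((continuous_genZ hf b).measurable.comp (hZ.measurable_path ω))
        (fun r => (hC _ (hZ.pos _ ω).le).2)
    have := intervalIntegral.integral_interval_sub_left (hint 0 t) (hint 0 s)
    simp only [hM, Pi.mul_apply, martIncr, Real.coe_toNNReal _ h0, Real.coe_toNNReal _ (h0.trans hst)]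
    rw [← this]
    ring
  simp only [hincr]
  rw [integral_sub (hVint _) (hVint _), sub_eq_zero, ← integral_condExp (ℱ.le s.toNNReal)]
  refine integral_congr_ae ?_
  have h1 := condExp_mul_of_stronglyMeasurable_left (m := ℱ s.toNNReal) hV.stronglyMeasurable
    (hVint t.toNNReal) (hmart.integrable _)
  filter_upwards [h1, hmart.2 _ _ hle] with ω e1 e2
  rw [e1, Pi.mul_apply, Pi.mul_apply, e2]

/-- The martingale problem, for the enlarged class of test functions. -/
lemma integral_mul_martIncr [IsProbabilityMeasure μ] (hZ : IsProcessZ μ ℱ b Z) {f : ℝ → ℝ}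
    (hf : IsTest f) {s t : ℝ}
    (h0 : 0 ≤ s) (hst : s ≤ t) {V : Ω → ℝ} (hV : Measurable[ℱ s.toNNReal] V) {B : ℝ}
    (hB : ∀ ω, |V ω| ≤ B) :
    ∫ ω, V ω * martIncr b f Z s t ω ∂μ = 0 := by
  obtain ⟨a, C, g, hg, hgs, hgC, hlim⟩ := hf.exists_cutoff b
  have hVm : Measurable V := hV.mono (ℱ.le _) le_rfl
  have hzero : ∀ n, ∫ ω, V ω * martIncr b (g n) Z s t ω ∂μ = 0 := fun n =>
    hZ.integral_mul_martIncr_of_hasCompactSupport (hg n) (hgs n) h0 hst hV hB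
  have htend : Tendsto (fun n => ∫ ω, V ω * martIncr b (g n) Z s t ω ∂μ) atTop
      (𝓝 (∫ ω, V ω * martIncr b f Z s t ω ∂μ)) := by
    refine tendsto_integral_of_dominated_convergence (fun _ => B * (2 * C + C * (t - s)))
      (fun n => (hVm.mul (hZ.measurable_martIncr (hg n) s t)).aestronglyMeasurable)
      (integrable_const _) (fun n => Eventually.of_forall fun ω => ?_)
      (Eventually.of_forall fun ω => ?_)
    · rw [Real.norm_eq_abs, abs_mul]
      exact mul_le_mul (hB ω) (hZ.abs_martIncr_le (hgC n) hst ω) (abs_nonneg _)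
        ((abs_nonneg _).trans (hB ω))
    · refine Tendsto.const_mul _ ?_
      have hI : Tendsto (fun n => ∫ r in s..t, genZ b (g n) (Z r.toNNReal ω)) atTop
          (𝓝 (∫ r in s..t, genZ b f (Z r.toNNReal ω))) := by
        refine intervalIntegral.tendsto_integral_filter_of_dominated_convergence (fun _ => C)
          (Eventually.of_forall fun n => ((continuous_genZ (hg n) b).measurable.comp
            (hZ.measurable_path ω)).aestronglyMeasurable)
          (Eventually.of_forall fun n => Eventually.of_forall fun r _ =>
            (hgC n _ (hZ.pos _ ω).le).2) intervalIntegrable_const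
          (Eventually.of_forall fun r _ => ?_)
        refine tendsto_const_nhds.congr' ?_
        filter_upwards [hlim _ (hZ.pos r.toNNReal ω).le] with n hn using hn.2.symm
      have hX : ∀ r, Tendsto (fun n => g n (Z r ω)) atTop (𝓝 (f (Z r ω) - a)) := fun r => by
        refine tendsto_const_nhds.congr' ?_
        filter_upwards [hlim _ (hZ.pos r ω).le] with n hn using hn.1.symm
      have := ((hX t.toNNReal).sub (hX s.toNNReal)).sub hI
      rwa [sub_sub_sub_cancel_right] at this
  simp only [hzero] at htend
  exact (tendsto_nhds_unique htend tendsto_const_nhds)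

end IsProcessZ

/-! ### The branching property -/

lemma mul_exp_neg_le {θ : ℝ} (hθ : 0 < θ) (x : ℝ) : x * Real.exp (-θ * x) ≤ 1 / θ := by
  have h1 := Real.add_one_le_exp (θ * x)
  have h2 : Real.exp (θ * x) * Real.exp (-θ * x) = 1 := by
    rw [← Real.exp_add]; simp
  have h3 := Real.exp_pos (-θ * x)
  rw [le_div_iff₀ hθ]
  nlinarith

lemma one_add_mul_exp_neg_le {θ : ℝ} (hθ : 0 < θ) {x : ℝ} (hx : 0 ≤ x) :
    (1 + x) * Real.exp (-θ * x) ≤ 1 + 1 / θ := by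
  have h1 := mul_exp_neg_le hθ x
  have h2 : Real.exp (-θ * x) ≤ 1 := Real.exp_le_one_iff.2 (by nlinarith)
  linarith

lemma deriv_exp_neg_mul (θ x : ℝ) :
    deriv (fun x => Real.exp (-θ * x)) x = -θ * Real.exp (-θ * x) := by
  have := ((hasDerivAt_id x).const_mul (-θ)).exp.deriv
  simp only [id, mul_one] at this
  rw [this, mul_comm]

lemma isTest_exp {θ : ℝ} (hθ : 0 < θ) : IsTest fun x => Real.exp (-θ * x) := by
  refine ⟨by fun_prop, 0, max 1 θ * (1 + 1 / θ), fun x hx => ⟨?_, ?_⟩⟩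
  · rw [sub_zero, abs_of_pos (Real.exp_pos _)]
    exact (one_add_mul_exp_neg_le hθ hx).trans (le_mul_of_one_le_left (by positivity) (le_max_left _ _))
  · rw [deriv_exp_neg_mul, abs_mul, abs_neg, abs_of_pos hθ, abs_of_pos (Real.exp_pos _)]
    calc (1 + x) * (θ * Real.exp (-θ * x)) = θ * ((1 + x) * Real.exp (-θ * x)) := by ring
      _ ≤ max 1 θ * (1 + 1 / θ) :=
        mul_le_mul (le_max_right _ _) (one_add_mul_exp_neg_le hθ hx) (by positivity) (by positivity)

lemma genZ_exp (b θ x : ℝ) :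
    genZ b (fun x => Real.exp (-θ * x)) x = x * branchMech b θ * Real.exp (-θ * x) := by
  have h2 : Real.exp (-θ * (x + 1)) = Real.exp (-θ * x) * Real.exp (-θ) := by
    rw [← Real.exp_add]; ring_nf
  simp only [genZ, branchMech, deriv_exp_neg_mul, h2]
  ring

lemma abs_genZ_exp_le {b θ x : ℝ} (hb : 1 < b) (hθ : 0 < θ) (hx : 0 ≤ x) :
    |genZ b (fun x => Real.exp (-θ * x)) x| ≤ b := by
  have h0 := branchMech_nonneg hb hθ.le
  rw [genZ_exp, abs_of_nonneg (by positivity)]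
  calc x * branchMech b θ * Real.exp (-θ * x) = branchMech b θ * (x * Real.exp (-θ * x)) := by ring
    _ ≤ (b * θ) * (1 / θ) :=
      mul_le_mul (branchMech_lt hθ).le (mul_exp_neg_le hθ x) (by positivity) (by positivity)
    _ = b := by field_simp

lemma abs_exp_neg_sub_le {v₀ v w x : ℝ} (h0 : 0 < v₀) (hv : v₀ ≤ v) (hw : v₀ ≤ w) (hx : 0 ≤ x) :
    |Real.exp (-v * x) - Real.exp (-w * x)| ≤ |v - w| / v₀ := by
  wlog h : v ≤ w generalizing v w
  · rw [abs_sub_comm, abs_sub_comm v]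
    exact this hw hv (le_of_not_ge h)
  have h1 := Real.add_one_le_exp (-(w - v) * x)
  have h2 : Real.exp (-w * x) = Real.exp (-v * x) * Real.exp (-(w - v) * x) := by
    rw [← Real.exp_add]; ring_nf
  have h3 : Real.exp (-w * x) ≤ Real.exp (-v * x) := Real.exp_le_exp.2 (by nlinarith)
  rw [abs_of_nonneg (by linarith), abs_of_nonpos (by linarith), h2]
  have h4 : Real.exp (-v * x) ≤ Real.exp (-v₀ * x) := Real.exp_le_exp.2 (by nlinarith)
  have h5 := Real.exp_pos (-v * x)
  have h6 := mul_exp_neg_le h0 x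
  calc Real.exp (-v * x) - Real.exp (-v * x) * Real.exp (-(w - v) * x)
      ≤ (w - v) * (x * Real.exp (-v * x)) := by nlinarith
    _ ≤ (w - v) * (1 / v₀) := by
        refine mul_le_mul_of_nonneg_left (le_trans ?_ h6) (by linarith)
        exact mul_le_mul_of_nonneg_left h4 hx
    _ = -(v - w) / v₀ := by ring

/-- Derivative of `r ↦ exp(-v r y)` when the frozen value `y` is replaced by `y r → y`. -/
lemma tendsto_slope_exp_neg {l : Filter ℝ} {v y : ℝ → ℝ} {r₀ v' y₀ : ℝ}
    (hv : Tendsto (fun r => (r - r₀)⁻¹ * (v r - v r₀)) l (𝓝 v')) (hv0 : Tendsto v l (𝓝 (v r₀)))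
    (hy : Tendsto y l (𝓝 y₀)) :
    Tendsto (fun r => (r - r₀)⁻¹ * (Real.exp (-v r * y r) - Real.exp (-v r₀ * y r))) l
      (𝓝 (-(v' * y₀) * Real.exp (-v r₀ * y₀))) := by
  have hφ : ContinuousAt (dslope Real.exp 0) 0 :=
    continuousAt_dslope_same.2 Real.differentiableAt_exp
  have hd : Tendsto (fun r => -(v r - v r₀) * y r) l (𝓝 0) := by
    have := ((hv0.sub_const (v r₀)).neg).mul hy
    simpa using this
  have h1 := hφ.tendsto.comp hd
  rw [dslope_same, Real.deriv_exp, Real.exp_zero] at h1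
  have h2 : Tendsto (fun r => Real.exp (-v r₀ * y r)) l (𝓝 (Real.exp (-v r₀ * y₀))) :=
    (Real.continuous_exp.tendsto _).comp (hy.const_mul _)
  have h3 := (((hv.mul hy).neg).mul h2).mul h1
  rw [mul_one] at h3
  refine h3.congr fun r => ?_
  have h4 : Real.exp (-v r * y r) = Real.exp (-v r₀ * y r) * Real.exp (-(v r - v r₀) * y r) := by
    rw [← Real.exp_add]; ring_nf
  have h5 := sub_smul_dslope Real.exp 0 (-(v r - v r₀) * y r)
  rw [Real.exp_zero, sub_zero, smul_eq_mul] at h5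
  rw [h4, Function.comp_apply]
  linear_combination ((r - r₀)⁻¹ * Real.exp (-v r₀ * y r)) * h5

namespace IsProcessZ

variable {Ω : Type*} {m : MeasurableSpace Ω} {μ : Measure Ω} {ℱ : Filtration ℝ≥0 m} {b : ℝ}
  {Z : ℝ≥0 → Ω → ℝ}

/-- Right-continuity of the path makes the time integral of a continuous function of it
differentiable from the right. -/
lemma hasDerivWithinAt_integral (hZ : IsProcessZ μ ℱ b Z) {k : ℝ → ℝ} (hk : Continuous k) {C : ℝ}
    (hC : ∀ x, 0 ≤ x → |k x| ≤ C) (ω : Ω) (s t : ℝ) :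
    HasDerivWithinAt (fun q => ∫ r in s..q, k (Z r.toNNReal ω)) (k (Z t.toNNReal ω))
      (Set.Ioi t) t := by
  have hmeas : Measurable fun r : ℝ => k (Z r.toNNReal ω) :=
    hk.measurable.comp (hZ.measurable_path ω)
  have := intervalIntegral.integral_hasDerivWithinAt_right (s := Set.Ici t) (t := Set.Ioi t)
    (intervalIntegrable_of_measurable_of_abs_le hmeas (fun r => hC _ (hZ.pos _ ω).le) s t)
    hmeas.stronglyMeasurable.stronglyMeasurableAtFilter
    ((hk.continuousAt.comp_continuousWithinAt (hZ.rightCont ω t)).mono Set.Ioi_subset_Ici_self)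
  exact this.mono Set.Ioi_subset_Ici_self

lemma integrable_mul_exp [IsProbabilityMeasure μ] (hZ : IsProcessZ μ ℱ b Z) {V : Ω → ℝ}
    (hV : Measurable V) {B : ℝ} (hB : ∀ ω, |V ω| ≤ B) {θ : ℝ} (hθ : 0 ≤ θ) (r : ℝ≥0) :
    Integrable (fun ω => V ω * Real.exp (-θ * Z r ω)) μ := by
  refine integrable_of_measurable_of_abs_le
    (hV.mul (((hZ.measurable r).const_mul _).exp)) (C := B) fun ω => ?_
  have h1 : Real.exp (-θ * Z r ω) ≤ 1 :=
    Real.exp_le_one_iff.2 (by have := hZ.pos r ω; nlinarith)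
  rw [abs_mul, abs_of_pos (Real.exp_pos _)]
  calc |V ω| * Real.exp (-θ * Z r ω) ≤ |V ω| * 1 := mul_le_mul_of_nonneg_left h1 (abs_nonneg _)
    _ ≤ B := by rw [mul_one]; exact hB ω

/-- Along the flow of `-ψ` run backwards from the final time, Laplace transforms are constant. -/
lemma integral_mul_exp_flow [IsProbabilityMeasure μ] (hZ : IsProcessZ μ ℱ b Z) (hb : 1 < b)
    {θ : ℝ} (hθ : 0 < θ) {u : ℝ → ℝ} (hu0 : u 0 = θ)
    (hu : ∀ t, 0 ≤ t → θ * Real.exp (-b * t) ≤ u t ∧ u t ≤ θ ∧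
      HasDerivWithinAt u (-branchMech b (u t)) (Set.Ici 0) t)
    {s T : ℝ} (h0 : 0 ≤ s) (hsT : s ≤ T) {V : Ω → ℝ} (hV : Measurable[ℱ s.toNNReal] V) {B : ℝ}
    (hB : ∀ ω, |V ω| ≤ B) :
    ∫ ω, V ω * Real.exp (-θ * Z T.toNNReal ω) ∂μ =
      ∫ ω, V ω * Real.exp (-(u (T - s)) * Z s.toNNReal ω) ∂μ := by
  have hVm : Measurable V := hV.mono (ℱ.le _) le_rfl
  have hB0 : 0 ≤ B := by
    obtain ⟨ω⟩ : Nonempty Ω := nonempty_of_isProbabilityMeasure μ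
    exact (abs_nonneg _).trans (hB ω)
  set v : ℝ → ℝ := fun r => u (T - r) with hv
  set v₀ : ℝ := θ * Real.exp (-b * (T - s)) with hv₀
  have hv₀pos : 0 < v₀ := by positivity
  have hvge : ∀ r ∈ Set.Icc s T, v₀ ≤ v r := fun r hr => by
    refine le_trans ?_ (hu (T - r) (by linarith [hr.2])).1
    refine mul_le_mul_of_nonneg_left (Real.exp_le_exp.2 ?_) hθ.le
    nlinarith [hr.1]
  have hvcont : ContinuousOn v (Set.Icc s T) := by
    have h1 : ContinuousOn u (Set.Ici 0) := fun t ht => (hu t ht).2.2.continuousWithinAt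
    exact h1.comp (by fun_prop) fun r hr => sub_nonneg.2 hr.2
  have hvderiv : ∀ r ∈ Set.Ico s T, HasDerivAt v (branchMech b (v r)) r := by
    intro r hr
    have h1 : 0 < T - r := by linarith [hr.2]
    have h2 := ((hu (T - r) h1.le).2.2.hasDerivAt (Ici_mem_nhds h1)).comp r
      ((hasDerivAt_id r).const_sub T)
    exact h2.congr_deriv (by simp [hv])
  set g : ℝ → ℝ := fun r => ∫ ω, V ω * Real.exp (-(v r) * Z r.toNNReal ω) ∂μ with hg
  -- Split an increment of `g` into the change of the exponent and the change of the process.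
  have hincr : ∀ r ∈ Set.Icc s T, ∀ q ∈ Set.Icc s T, r ≤ q → g q - g r =
      ∫ ω, V ω * (Real.exp (-(v q) * Z q.toNNReal ω) - Real.exp (-(v r) * Z q.toNNReal ω) +
        ∫ p in r..q, genZ b (fun x => Real.exp (-(v r) * x)) (Z p.toNNReal ω)) ∂μ := by
    intro r hr q hq hrq
    have hvr : 0 < v r := hv₀pos.trans_le (hvge r hr)
    have hvq : 0 < v q := hv₀pos.trans_le (hvge q hq)
    obtain ⟨C, hC⟩ := (isTest_exp hvr).exists_bound b
    have hz := hZ.integral_mul_martIncr (isTest_exp hvr) (h0.trans hr.1) hrq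
      (hV.mono (ℱ.mono (Real.toNNReal_mono hr.1)) le_rfl) hB
    have i1 := hZ.integrable_mul_exp hVm hB hvq.le q.toNNReal
    have i2 := hZ.integrable_mul_exp hVm hB hvr.le r.toNNReal
    have i3 : Integrable (fun ω => V ω *
        martIncr b (fun x => Real.exp (-(v r) * x)) Z r q ω) μ := by
      refine integrable_of_measurable_of_abs_le
        (hVm.mul (hZ.measurable_martIncr (isTest_exp hvr).contDiff r q))
        (C := B * (2 * C + C * (q - r))) fun ω => ?_
      rw [abs_mul]
      exact mul_le_mul (hB ω) (hZ.abs_martIncr_le hC hrq ω) (abs_nonneg _) hB0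
    have h1 : g q - g r = ∫ ω, (V ω * Real.exp (-(v q) * Z q.toNNReal ω) -
        V ω * Real.exp (-(v r) * Z r.toNNReal ω)) -
          V ω * martIncr b (fun x => Real.exp (-(v r) * x)) Z r q ω ∂μ := by
      have i12 : Integrable (fun ω => V ω * Real.exp (-(v q) * Z q.toNNReal ω) -
        V ω * Real.exp (-(v r) * Z r.toNNReal ω)) μ := i1.sub i2
      rw [integral_sub i12 i3, integral_sub i1 i2, hz, sub_zero]
    rw [h1]
    refine integral_congr_ae (Eventually.of_forall fun ω => ?_)
    simp only [martIncr]
    ring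
  have hpath : ∀ r ∈ Set.Icc s T, ∀ q ∈ Set.Icc s T, r ≤ q → ∀ ω,
      |Real.exp (-(v q) * Z q.toNNReal ω) - Real.exp (-(v r) * Z q.toNNReal ω) +
        ∫ p in r..q, genZ b (fun x => Real.exp (-(v r) * x)) (Z p.toNNReal ω)| ≤
      |v q - v r| / v₀ + b * (q - r) := by
    intro r hr q hq hrq ω
    refine (abs_add_le _ _).trans (add_le_add
      (abs_exp_neg_sub_le hv₀pos (hvge q hq) (hvge r hr) (hZ.pos _ ω).le)
      (abs_intervalIntegral_le (fun p => ?_) hrq))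
    exact abs_genZ_exp_le hb (hv₀pos.trans_le (hvge r hr)) (hZ.pos _ ω).le
  have hmodulus : ∀ r ∈ Set.Icc s T, ∀ q ∈ Set.Icc s T,
      |g q - g r| ≤ B * (|v q - v r| / v₀ + b * |q - r|) := by
    intro r hr q hq
    wlog hrq : r ≤ q generalizing r q
    · rw [abs_sub_comm, abs_sub_comm (v q), abs_sub_comm q]
      exact this q hq r hr (le_of_not_ge hrq)
    rw [hincr r hr q hq hrq, abs_of_nonneg (sub_nonneg.2 hrq)]
    have hnorm : ∀ ω, ‖V ω * (Real.exp (-(v q) * Z q.toNNReal ω) -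
        Real.exp (-(v r) * Z q.toNNReal ω) +
        ∫ p in r..q, genZ b (fun x => Real.exp (-(v r) * x)) (Z p.toNNReal ω))‖ ≤
        B * (|v q - v r| / v₀ + b * (q - r)) := fun ω => by
      rw [Real.norm_eq_abs, abs_mul]
      exact mul_le_mul (hB ω) (hpath r hr q hq hrq ω) (abs_nonneg _) hB0
    have := norm_integral_le_of_norm_le_const (μ := μ) (Eventually.of_forall hnorm)
    rwa [probReal_univ, mul_one] at this
  have hgcont : ContinuousOn g (Set.Icc s T) := by
    intro r hr
    refine tendsto_iff_norm_sub_tendsto_zero.2 ?_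
    have h1 : Tendsto (fun q => B * (|v q - v r| / v₀ + b * |q - r|)) (𝓝[Set.Icc s T] r)
        (𝓝 (B * (|v r - v r| / v₀ + b * |r - r|))) := by
      have e1 : Tendsto (fun q : ℝ => q) (𝓝[Set.Icc s T] r) (𝓝 r) := nhdsWithin_le_nhds
      exact ((((hvcont r hr).tendsto.sub_const _).abs.div_const _).add
        ((e1.sub_const _).abs.const_mul _)).const_mul _
    simp only [sub_self, abs_zero, zero_div, mul_zero, add_zero] at h1
    refine tendsto_of_tendsto_of_tendsto_of_le_of_le' tendsto_const_nhds h1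
      (Eventually.of_forall fun _ => norm_nonneg _) ?_
    filter_upwards [self_mem_nhdsWithin] with q hq using hmodulus r hr q hq
  have hgderiv : ∀ r ∈ Set.Ico s T, HasDerivWithinAt g 0 (Set.Ici r) r := by
    intro r hr
    have hr' : r ∈ Set.Icc s T := ⟨hr.1, hr.2.le⟩
    have hvr : 0 < v r := hv₀pos.trans_le (hvge r hr')
    have hmem : ∀ᶠ q in 𝓝[>] r, q ∈ Set.Icc s T ∧ r < q := by
      filter_upwards [self_mem_nhdsWithin, mem_nhdsWithin_of_mem_nhds (Iio_mem_nhds hr.2)]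
        with q h1 h2
      exact ⟨⟨hr.1.trans (le_of_lt h1), le_of_lt h2⟩, h1⟩
    have hvslope : Tendsto (fun q => (q - r)⁻¹ * (v q - v r)) (𝓝[>] r)
        (𝓝 (branchMech b (v r))) :=
      (hasDerivWithinAt_iff_tendsto_slope' (s := Set.Ioi r) Set.self_notMem_Ioi).1
        ((hvderiv r hr).hasDerivWithinAt (s := Set.Ioi r))
    have hvbdd : ∀ᶠ q in 𝓝[>] r, |(q - r)⁻¹ * (v q - v r)| ≤ |branchMech b (v r)| + 1 :=
      (hvslope.abs.eventually_lt_const (lt_add_one _)).mono fun _ h => h.le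
    rw [← hasDerivWithinAt_Ioi_iff_Ici, hasDerivWithinAt_iff_tendsto_slope' (s := Set.Ioi r) Set.self_notMem_Ioi]
    have hlim : Tendsto (fun q => ∫ ω, V ω * ((q - r)⁻¹ *
        (Real.exp (-(v q) * Z q.toNNReal ω) - Real.exp (-(v r) * Z q.toNNReal ω) +
          ∫ p in r..q, genZ b (fun x => Real.exp (-(v r) * x)) (Z p.toNNReal ω))) ∂μ) (𝓝[>] r)
        (𝓝 (∫ _, 0 ∂μ)) := by
      refine tendsto_integral_filter_of_dominated_convergence
        (fun _ => B * ((|branchMech b (v r)| + 1) / v₀ + b)) (Eventually.of_forall fun q => ?_)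
        ?_ (integrable_const _) (Eventually.of_forall fun ω => ?_)
      · refine (hVm.mul (Measurable.const_mul ?_ _)).aestronglyMeasurable
        exact ((((hZ.measurable _).const_mul _).exp.sub ((hZ.measurable _).const_mul _).exp)).add
          (hZ.measurable_integral (continuous_genZ (isTest_exp hvr).contDiff b).measurable r q)
      · filter_upwards [hmem, hvbdd] with q hq hq2
        refine Eventually.of_forall fun ω => ?_
        have hqr : 0 < q - r := sub_pos.2 hq.2
        rw [Real.norm_eq_abs, abs_mul]
        refine mul_le_mul (hB ω) ?_ (abs_nonneg _) hB0
        rw [abs_mul, abs_of_pos (inv_pos.2 hqr)]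
        rw [abs_mul, abs_of_pos (inv_pos.2 hqr)] at hq2
        calc (q - r)⁻¹ * _ ≤ (q - r)⁻¹ * (|v q - v r| / v₀ + b * (q - r)) :=
              mul_le_mul_of_nonneg_left (hpath r hr' q hq.1 hq.2.le ω) (inv_pos.2 hqr).le
          _ = ((q - r)⁻¹ * |v q - v r|) / v₀ + b := by field_simp
          _ ≤ _ := by gcongr
      · have h1 := tendsto_slope_exp_neg hvslope
          ((hvcont.continuousWithinAt hr').tendsto.mono_left
            (nhdsWithin_le_of_mem (hmem.mono fun q h => h.1)))
          ((hZ.rightCont ω r).mono Set.Ioi_subset_Ici_self).tendsto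
        have h2 := (hasDerivWithinAt_iff_tendsto_slope' (s := Set.Ioi r) Set.self_notMem_Ioi).1
          (hZ.hasDerivWithinAt_integral (continuous_genZ (isTest_exp hvr).contDiff b)
            (fun x hx => abs_genZ_exp_le hb hvr hx) ω r r)
        have h3 := (h1.add h2).const_mul (V ω)
        rw [genZ_exp] at h3
        convert h3 using 2 with q
        · rw [slope_def_field, intervalIntegral.integral_same]
          ring
        · ring
    rw [integral_zero] at hlim
    refine hlim.congr' ?_
    filter_upwards [hmem] with q hq
    rw [slope_def_field, hincr r hr' q hq.1 hq.2.le, div_eq_inv_mul, ← integral_const_mul]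
    refine integral_congr_ae (Eventually.of_forall fun ω => ?_)
    simp only
    ring
  have := constant_of_has_deriv_right_zero hgcont hgderiv T ⟨hsT, le_rfl⟩
  simpa [hg, hv, hu0] using this

theorem isCSBP [IsProbabilityMeasure μ] (hZ : IsProcessZ μ ℱ b Z) (hb : 1 < b) :
    IsCSBP μ ℱ (branchMech b) Z := by
  have hex : ∀ θ : ℝ, ∃ u : ℝ → ℝ, 0 < θ → u 0 = θ ∧ ∀ t, 0 ≤ t →
      θ * Real.exp (-b * t) ≤ u t ∧ u t ≤ θ ∧
        HasDerivWithinAt u (-branchMech b (u t)) (Set.Ici 0) t := by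
    intro θ
    by_cases hθ : 0 < θ
    · obtain ⟨u, hu⟩ := exists_branchMech_flow hb hθ
      exact ⟨u, fun _ => hu⟩
    · exact ⟨0, fun h => absurd h hθ⟩
  choose U hU using hex
  refine ⟨isBranchingMechanism_branchMech b, hZ.adapted, fun t ω => (hZ.pos t ω).le,
    fun t θ => U θ t, fun θ hθ => ⟨(hU θ hθ).1, fun t => ⟨?_, ?_⟩⟩, fun θ hθ s t => ?_⟩
  · exact le_trans (by positivity) ((hU θ hθ).2 t t.coe_nonneg).1
  · refine ((hU θ hθ).2 t t.coe_nonneg).2.2.congr (fun r hr => ?_) ?_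
    · simp only [Real.coe_toNNReal r hr]
    · simp only [Real.toNNReal_coe]
  · have hu := (hU θ hθ).2 t t.coe_nonneg
    have hu0 : 0 ≤ U θ t := le_trans (by positivity) hu.1
    have hint : ∀ (q : ℝ), 0 ≤ q → ∀ r, Integrable (fun ω => Real.exp (-q * Z r ω)) μ := by
      intro q hq r
      simpa using hZ.integrable_mul_exp (V := fun _ => 1) measurable_const (B := 1) (by simp) hq r
    refine (ae_eq_condExp_of_forall_setIntegral_eq (ℱ.le s) (hint θ hθ.le (s + t))
      (fun A _ _ => (hint _ hu0 s).integrableOn) (fun A hA _ => ?_)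
      (((hZ.adapted s).const_mul _).exp.stronglyMeasurable.aestronglyMeasurable)).symm
    have hV : Measurable[ℱ (s : ℝ).toNNReal] (A.indicator fun _ => (1 : ℝ)) := by
      rw [Real.toNNReal_coe]
      exact measurable_const.indicator hA
    have := hZ.integral_mul_exp_flow hb hθ (hU θ hθ).1 (hU θ hθ).2 s.coe_nonneg
      (le_add_of_nonneg_right t.coe_nonneg : (s : ℝ) ≤ s + t) hV (B := 1) (fun ω => by
        by_cases h : ω ∈ A <;> simp [h])
    rw [add_sub_cancel_left, ← NNReal.coe_add, Real.toNNReal_coe, Real.toNNReal_coe] at this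
    have hind : ∀ g : Ω → ℝ, ∫ ω in A, g ω ∂μ = ∫ ω, A.indicator (fun _ => 1) ω * g ω ∂μ := by
      intro g
      rw [← integral_indicator (ℱ.le s A hA)]
      refine integral_congr_ae (Eventually.of_forall fun ω => ?_)
      by_cases h : ω ∈ A <;> simp [h]
    rw [hind, hind]
    exact this.symm

theorem isSubcriticalCSBP [IsProbabilityMeasure μ] (hZ : IsProcessZ μ ℱ b Z) (hb : 1 < b) :
    IsSubcriticalCSBP μ ℱ Z := by
  refine ⟨branchMech b, b - 1, hZ.isCSBP hb, ?_, by linarith⟩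
  have := (hasDerivAt_branchMech b 0).hasDerivWithinAt (s := Set.Ici 0)
  simpa using this

/-! ### The downward drift is at most `b x` -/

/-- Letting `θ → ∞` in the Laplace transform, whose exponent is at least `θ exp(-b (t - s))`. -/
lemma ae_le_of_le [IsProbabilityMeasure μ] (hZ : IsProcessZ μ ℱ b Z) (hb : 1 < b) {s t : ℝ}
    (h0 : 0 ≤ s) (hst : s ≤ t) :
    ∀ᵐ ω ∂μ, Real.exp (-b * (t - s)) * Z s.toNNReal ω ≤ Z t.toNNReal ω := by
  set ρ := Real.exp (-b * (t - s)) with hρ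
  have hρ0 : 0 < ρ := Real.exp_pos _
  have key : ∀ K n : ℕ, μ {ω | Z s.toNNReal ω ≤ K ∧
      Z t.toNNReal ω + 1 / ((n : ℝ) + 1) ≤ ρ * Z s.toNNReal ω} = 0 := by
    intro K n
    set δ : ℝ := 1 / ((n : ℝ) + 1) with hδ
    have hδ0 : 0 < δ := by positivity
    set S := {ω | Z s.toNNReal ω ≤ K ∧ Z t.toNNReal ω + δ ≤ ρ * Z s.toNNReal ω} with hS
    have hSm : MeasurableSet S :=
      (measurableSet_le (hZ.measurable _) measurable_const).inter
        (measurableSet_le ((hZ.measurable _).add_const _) ((hZ.measurable _).const_mul _))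
    have hbound : ∀ θ : ℕ, 0 < θ → μ.real S ≤ Real.exp (-δ * θ) := by
      intro θ hθ'
      have hθ : (0 : ℝ) < θ := by exact_mod_cast hθ'
      obtain ⟨u, hu0, hu⟩ := exists_branchMech_flow hb hθ
      set V : Ω → ℝ := {ω | Z s.toNNReal ω ≤ K}.indicator
        (fun ω => Real.exp (θ * ρ * Z s.toNNReal ω)) with hV
      have hVm : Measurable[ℱ s.toNNReal] V :=
        Measurable.indicator ((hZ.adapted _).const_mul _).exp
          (@measurableSet_le _ _ _ _ _ (ℱ s.toNNReal) _ _ _ _ _ (hZ.adapted _) measurable_const)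
      have hV0 : ∀ ω, 0 ≤ V ω := fun ω => Set.indicator_nonneg (fun _ _ => (Real.exp_pos _).le) ω
      have hVB : ∀ ω, |V ω| ≤ Real.exp (θ * ρ * K) := by
        intro ω
        rw [abs_of_nonneg (hV0 ω)]
        by_cases h : Z s.toNNReal ω ≤ K
        · rw [hV, Set.indicator_of_mem (by exact h)]
          exact Real.exp_le_exp.2 (mul_le_mul_of_nonneg_left h (by positivity))
        · rw [hV, Set.indicator_of_notMem (by exact h)]
          positivity
      have hVm' : Measurable V := hVm.mono (ℱ.le _) le_rfl
      have heq := hZ.integral_mul_exp_flow hb hθ hu0 hu h0 hst hVm hVB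
      have hus : θ * ρ ≤ u (t - s) := (hu (t - s) (sub_nonneg.2 hst)).1
      have hle1 : ∫ ω, V ω * Real.exp (-(u (t - s)) * Z s.toNNReal ω) ∂μ ≤ 1 := by
        have : ∫ ω, V ω * Real.exp (-(u (t - s)) * Z s.toNNReal ω) ∂μ ≤ ∫ _, (1 : ℝ) ∂μ := by
          refine integral_mono (hZ.integrable_mul_exp hVm' hVB
            (le_trans (by positivity) hus) _) (integrable_const _) fun ω => ?_
          by_cases h : Z s.toNNReal ω ≤ K
          · simp only [hV]
            rw [Set.indicator_of_mem (by exact h), ← Real.exp_add, Real.exp_le_one_iff]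
            have := hZ.pos s.toNNReal ω
            nlinarith
          · simp only [hV]
            rw [Set.indicator_of_notMem (by exact h)]
            simp
        simpa using this
      have hge : μ.real S * Real.exp (δ * θ) ≤ ∫ ω, V ω * Real.exp (-θ * Z t.toNNReal ω) ∂μ := by
        have : ∫ ω, S.indicator (fun _ => Real.exp (δ * θ)) ω ∂μ ≤
            ∫ ω, V ω * Real.exp (-θ * Z t.toNNReal ω) ∂μ := by
          refine integral_mono ((integrable_const _).indicator hSm)
            (hZ.integrable_mul_exp hVm' hVB hθ.le _) fun ω => ?_
          by_cases h : ω ∈ S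
          · have h1 : Z s.toNNReal ω ≤ K := h.1
            have h2 : Z t.toNNReal ω + δ ≤ ρ * Z s.toNNReal ω := h.2
            simp only [hV]
            rw [Set.indicator_of_mem h, Set.indicator_of_mem (by exact h1), ← Real.exp_add,
              Real.exp_le_exp]
            nlinarith
          · rw [Set.indicator_of_notMem h]
            exact mul_nonneg (hV0 ω) (Real.exp_pos _).le
        rwa [integral_indicator_const _ hSm, smul_eq_mul] at this
      have h1 : Real.exp (δ * θ) * Real.exp (-δ * θ) = 1 := by
        rw [← Real.exp_add]; simp
      have h2 := Real.exp_pos (-δ * θ)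
      have h3 : μ.real S * Real.exp (δ * θ) ≤ 1 := hge.trans (heq.trans_le hle1)
      nlinarith
    have hlim : Tendsto (fun θ : ℕ => Real.exp (-δ * θ)) atTop (𝓝 0) := by
      refine Real.tendsto_exp_atBot.comp ?_
      exact Tendsto.const_mul_atTop_of_neg (by linarith) tendsto_natCast_atTop_atTop
    have : μ.real S ≤ 0 := by
      refine ge_of_tendsto hlim ?_
      filter_upwards [eventually_gt_atTop 0] with θ hθ using hbound θ hθ
    have h0 : μ.real S = 0 := le_antisymm this measureReal_nonneg
    rwa [measureReal_eq_zero_iff] at h0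
  have hall : ∀ᵐ ω ∂μ, ∀ K n : ℕ, ¬ (Z s.toNNReal ω ≤ K ∧
      Z t.toNNReal ω + 1 / ((n : ℝ) + 1) ≤ ρ * Z s.toNNReal ω) := by
    rw [ae_all_iff]; intro K
    rw [ae_all_iff]; intro n
    rw [ae_iff]
    simpa only [not_not] using key K n
  filter_upwards [hall] with ω hω
  by_contra! hcon
  obtain ⟨K, hK⟩ := exists_nat_ge (Z s.toNNReal ω)
  obtain ⟨n, hn⟩ := exists_nat_one_div_lt (sub_pos.2 hcon)
  exact hω K n ⟨hK, by linarith⟩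

/-- Almost surely `exp(b t) Z t` is nondecreasing. -/
theorem ae_exp_mul_mono [IsProbabilityMeasure μ] (hZ : IsProcessZ μ ℱ b Z) (hb : 1 < b) :
    ∀ᵐ ω ∂μ, ∀ s t : ℝ, 0 ≤ s → s ≤ t →
      Real.exp (b * s) * Z s.toNNReal ω ≤ Real.exp (b * t) * Z t.toNNReal ω := by
  have hrat : ∀ᵐ ω ∂μ, ∀ p q : ℚ, 0 ≤ (p : ℝ) → (p : ℝ) ≤ q →
      Real.exp (b * p) * Z (p : ℝ).toNNReal ω ≤ Real.exp (b * q) * Z (q : ℝ).toNNReal ω := by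
    rw [ae_all_iff]; intro p
    rw [ae_all_iff]; intro q
    by_cases h : 0 ≤ (p : ℝ) ∧ (p : ℝ) ≤ q
    · filter_upwards [hZ.ae_le_of_le hb h.1 h.2] with ω hω _ _
      have h1 : Real.exp (b * p) = Real.exp (b * q) * Real.exp (-b * (q - p)) := by
        rw [← Real.exp_add]; ring_nf
      rw [h1, mul_assoc]
      exact mul_le_mul_of_nonneg_left hω (Real.exp_pos _).le
    · exact Eventually.of_forall fun ω h1 h2 => absurd ⟨h1, h2⟩ h
  filter_upwards [hrat] with ω hω s t h0 hst
  rcases hst.eq_or_lt with rfl | hst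
  · exact le_rfl
  obtain ⟨p, -, hp, hpl⟩ := Real.exists_seq_rat_strictAnti_tendsto s
  obtain ⟨q, -, hq, hql⟩ := Real.exists_seq_rat_strictAnti_tendsto t
  have hlim : ∀ (r : ℝ) (a : ℕ → ℚ), (∀ n, r < a n) → Tendsto (fun n => (a n : ℝ)) atTop (𝓝 r) →
      Tendsto (fun n => Real.exp (b * a n) * Z (a n : ℝ).toNNReal ω) atTop
        (𝓝 (Real.exp (b * r) * Z r.toNNReal ω)) := by
    intro r a ha hal
    exact ((Real.continuous_exp.tendsto _).comp (hal.const_mul b)).mul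
      ((hZ.rightCont ω r).tendsto.comp (tendsto_nhdsWithin_iff.2
        ⟨hal, Eventually.of_forall fun n => (ha n).le⟩))
  refine le_of_tendsto_of_tendsto (hlim s p hp hpl) (hlim t q hq hql) ?_
  filter_upwards [hpl.eventually_lt_const hst] with n hn
  exact hω _ _ (h0.trans (hp n).le) (hn.le.trans (hq n).le)

end IsProcessZ

/-! ### A Feynman–Kac formula -/

/-- The additive functional `∫₀ᵗ k (Z r) dr`. -/
noncomputable def addFunctional {Ω : Type*} (k : ℝ → ℝ) (Z : ℝ≥0 → Ω → ℝ) (t : ℝ) (ω : Ω) : ℝ :=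
  ∫ r in (0 : ℝ)..t, k (Z r.toNNReal ω)

namespace IsProcessZ

variable {Ω : Type*} {m : MeasurableSpace Ω} {μ : Measure Ω} {ℱ : Filtration ℝ≥0 m} {b : ℝ}
  {Z : ℝ≥0 → Ω → ℝ}

lemma intervalIntegrable_comp (hZ : IsProcessZ μ ℱ b Z) {k : ℝ → ℝ} (hk : Continuous k) {C : ℝ}
    (hC : ∀ x, 0 ≤ x → |k x| ≤ C) (ω : Ω) (s t : ℝ) :
    IntervalIntegrable (fun r : ℝ => k (Z r.toNNReal ω)) volume s t :=
  intervalIntegrable_of_measurable_of_abs_le (hk.measurable.comp (hZ.measurable_path ω))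
    (fun _ => hC _ (hZ.pos _ ω).le) s t

lemma continuous_addFunctional (hZ : IsProcessZ μ ℱ b Z) {k : ℝ → ℝ} (hk : Continuous k) {C : ℝ}
    (hC : ∀ x, 0 ≤ x → |k x| ≤ C) (ω : Ω) : Continuous fun t => addFunctional k Z t ω :=
  intervalIntegral.continuous_primitive (fun s t => hZ.intervalIntegrable_comp hk hC ω s t) 0

lemma measurable_addFunctional (hZ : IsProcessZ μ ℱ b Z) {k : ℝ → ℝ} (hk : Continuous k) {C : ℝ}
    (hC : ∀ x, 0 ≤ x → |k x| ≤ C) : Measurable fun p : ℝ × Ω => addFunctional k Z p.1 p.2 :=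
  (stronglyMeasurable_uncurry_of_continuous_of_stronglyMeasurable
    (u := fun t ω => addFunctional k Z t ω) (hZ.continuous_addFunctional hk hC)
    (fun t => (hZ.measurable_integral hk.measurable 0 t).stronglyMeasurable)).measurable

lemma addFunctional_le (hZ : IsProcessZ μ ℱ b Z) {k : ℝ → ℝ} {C : ℝ}
    (hC : ∀ x, 0 ≤ x → |k x| ≤ C) {t : ℝ} (ht : 0 ≤ t) (ω : Ω) : addFunctional k Z t ω ≤ C * t := by
  have := abs_intervalIntegral_le (f := fun r : ℝ => k (Z r.toNNReal ω))
    (fun r => hC _ (hZ.pos _ ω).le) ht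
  rw [sub_zero] at this
  exact (le_abs_self _).trans this

/-- Integration by parts along a path: the finite variation factor `exp ∫₀ᵗ k (Z)` turns
increments of the martingale attached to `f` into those attached to the product. -/
lemma path_identity (hZ : IsProcessZ μ ℱ b Z) {f k : ℝ → ℝ} (hf : IsTest f) (hk : Continuous k)
    {C : ℝ} (hC : ∀ x, 0 ≤ x → |k x| ≤ C) (t : ℝ) (ω : Ω) :
    f (Z t.toNNReal ω) * Real.exp (addFunctional k Z t ω) =
      f (Z 0 ω) + (∫ s in (0 : ℝ)..t, Real.exp (addFunctional k Z s ω) *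
        (genZ b f (Z s.toNNReal ω) + k (Z s.toNNReal ω) * f (Z s.toNNReal ω))) +
      martIncr b f Z 0 t ω + ∫ s in (0 : ℝ)..t,
        (Real.exp (addFunctional k Z s ω) * k (Z s.toNNReal ω)) * martIncr b f Z s t ω := by
  obtain ⟨D, hD⟩ := hf.exists_bound b
  have hG := continuous_genZ hf.contDiff b
  set V : ℝ → ℝ := fun s => Real.exp (addFunctional k Z s ω) with hVdef
  set A : ℝ → ℝ := fun s => addFunctional (genZ b f) Z s ω with hAdef
  set X : ℝ → ℝ := fun s => f (Z s.toNNReal ω) with hXdef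
  set κ : ℝ → ℝ := fun s => k (Z s.toNNReal ω) with hκdef
  set G : ℝ → ℝ := fun s => genZ b f (Z s.toNNReal ω) with hGdef
  have hVc : Continuous V := Real.continuous_exp.comp (hZ.continuous_addFunctional hk hC ω)
  have hAc : Continuous A := hZ.continuous_addFunctional hG (fun x hx => (hD x hx).2) ω
  have hV' : ∀ s, HasDerivWithinAt V (V s * κ s) (Set.Ioi s) s := fun s =>
    (hZ.hasDerivWithinAt_integral hk hC ω 0 s).exp
  have hA' : ∀ s, HasDerivWithinAt A (G s) (Set.Ioi s) s := fun s =>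
    hZ.hasDerivWithinAt_integral hG (fun x hx => (hD x hx).2) ω 0 s
  have iκ : IntervalIntegrable κ volume 0 t := hZ.intervalIntegrable_comp hk hC ω 0 t
  have iG : IntervalIntegrable G volume 0 t :=
    hZ.intervalIntegrable_comp hG (fun x hx => (hD x hx).2) ω 0 t
  have iVκ : IntervalIntegrable (fun s => V s * κ s) volume 0 t :=
    iκ.continuousOn_mul hVc.continuousOn
  have iκX : IntervalIntegrable (fun s => κ s * X s) volume 0 t :=
    hZ.intervalIntegrable_comp (k := fun x => k x * f x) (hk.mul hf.contDiff.continuous)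
      (C := C * D) (fun x hx => by
        rw [abs_mul]
        exact mul_le_mul (hC x hx) (hD x hx).1 (abs_nonneg _) ((abs_nonneg _).trans (hC x hx))) ω 0 t
  have iVκX : IntervalIntegrable (fun s => V s * (κ s * X s)) volume 0 t :=
    iκX.continuousOn_mul hVc.continuousOn
  have iVG : IntervalIntegrable (fun s => V s * G s) volume 0 t :=
    iG.continuousOn_mul hVc.continuousOn
  have iAVκ : IntervalIntegrable (fun s => A s * (V s * κ s)) volume 0 t :=
    iVκ.continuousOn_mul hAc.continuousOn
  have hV0 : V 0 = 1 := by simp [hVdef, addFunctional]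
  have hA0 : A 0 = 0 := by simp [hAdef, addFunctional]
  have e1 : ∫ s in (0 : ℝ)..t, V s * κ s = V t - V 0 :=
    intervalIntegral.integral_eq_sub_of_hasDeriv_right hVc.continuousOn (fun s _ => hV' s) iVκ
  have e2 : ∫ s in (0 : ℝ)..t, A s * (V s * κ s) = A t * V t - A 0 * V 0 -
      ∫ s in (0 : ℝ)..t, G s * V s :=
    intervalIntegral.integral_mul_deriv_eq_deriv_mul_of_hasDeriv_right hAc.continuousOn
      hVc.continuousOn (fun s _ => hA' s) (fun s _ => hV' s) iG iVκ
  have e3 : ∀ s, martIncr b f Z s t ω = X t - X s - (A t - A s) := by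
    intro s
    have := intervalIntegral.integral_interval_sub_left
      (hZ.intervalIntegrable_comp hG (fun x hx => (hD x hx).2) ω 0 t)
      (hZ.intervalIntegrable_comp hG (fun x hx => (hD x hx).2) ω 0 s)
    simp only [martIncr, hAdef, addFunctional, this, hXdef]
  have e4 : ∫ s in (0 : ℝ)..t, (V s * κ s) * martIncr b f Z s t ω =
      (X t - A t) * (V t - 1) - (∫ s in (0 : ℝ)..t, V s * (κ s * X s)) +
        (A t * V t - ∫ s in (0 : ℝ)..t, V s * G s) := by
    have : ∀ s, (V s * κ s) * martIncr b f Z s t ω =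
        (X t - A t) * (V s * κ s) - V s * (κ s * X s) + A s * (V s * κ s) := by
      intro s; rw [e3]; ring
    simp only [this]
    rw [intervalIntegral.integral_add ((iVκ.const_mul _).sub iVκX) iAVκ,
      intervalIntegral.integral_sub (iVκ.const_mul _) iVκX, intervalIntegral.integral_const_mul,
      e1, e2, hV0, hA0]
    simp only [mul_comm (G _)]
    ring
  have e5 : ∫ s in (0 : ℝ)..t, V s * (G s + κ s * X s) =
      (∫ s in (0 : ℝ)..t, V s * G s) + ∫ s in (0 : ℝ)..t, V s * (κ s * X s) := by
    rw [← intervalIntegral.integral_add iVG iVκX]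
    simp only [mul_add]
  have e6 : X 0 = f (Z 0 ω) := by simp [hXdef]
  rw [e4, e5, e3 0, hA0, ← e6]
  ring

/-- A Feynman–Kac formula for the process: the potential `k` need only be bounded on `[0, ∞)`. -/
theorem feynmanKac [IsProbabilityMeasure μ] (hZ : IsProcessZ μ ℱ b Z) {f k : ℝ → ℝ}
    (hf : IsTest f) (hk : Continuous k) {C : ℝ} (hC : ∀ x, 0 ≤ x → |k x| ≤ C) {t : ℝ}
    (ht : 0 ≤ t) :
    ∫ ω, f (Z t.toNNReal ω) * Real.exp (addFunctional k Z t ω) ∂μ =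
      f 1 + ∫ s in (0 : ℝ)..t, (∫ ω, Real.exp (addFunctional k Z s ω) *
        (genZ b f (Z s.toNNReal ω) + k (Z s.toNNReal ω) * f (Z s.toNNReal ω)) ∂μ) := by
  obtain ⟨D, hD⟩ := hf.exists_bound b
  have hG := continuous_genZ hf.contDiff b
  have hfc := hf.contDiff.continuous
  have hC0 : 0 ≤ C := (abs_nonneg _).trans (hC 0 le_rfl)
  have hD0 : 0 ≤ D := (abs_nonneg _).trans (hD 0 le_rfl).1
  set E : ℝ := Real.exp (C * t) with hE
  have hE0 : 0 < E := Real.exp_pos _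
  have hVE : ∀ s ∈ Set.Ioc 0 t, ∀ ω, Real.exp (addFunctional k Z s ω) ≤ E := fun s hs ω =>
    Real.exp_le_exp.2 ((hZ.addFunctional_le hC hs.1.le ω).trans
      (mul_le_mul_of_nonneg_left hs.2 hC0))
  have hVm : Measurable fun p : Ω × ℝ => Real.exp (addFunctional k Z p.2 p.1) :=
    ((hZ.measurable_addFunctional hk hC).comp measurable_swap).exp
  have hYm : Measurable fun p : Ω × ℝ => Z p.2.toNNReal p.1 :=
    hZ.measurable_uncurry.comp measurable_swap
  -- integrability on the product space of bounded measurable integrands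
  have hprod : ∀ (F : Ω → ℝ → ℝ) (B : ℝ), Measurable (Function.uncurry F) →
      (∀ ω, ∀ s ∈ Set.Ioc 0 t, |F ω s| ≤ B) →
      Integrable (Function.uncurry F) (μ.prod (volume.restrict (Set.Ioc 0 t))) := by
    intro F B hF hB
    refine Integrable.of_bound hF.aestronglyMeasurable B ?_
    have : ∀ᵐ p ∂(μ.prod (volume.restrict (Set.Ioc 0 t))), p.2 ∈ Set.Ioc 0 t :=
      Measure.quasiMeasurePreserving_snd.ae (ae_restrict_mem measurableSet_Ioc)
    filter_upwards [this] with p hp using hB p.1 p.2 hp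
  set F₁ : Ω → ℝ → ℝ := fun ω s => Real.exp (addFunctional k Z s ω) *
    (genZ b f (Z s.toNNReal ω) + k (Z s.toNNReal ω) * f (Z s.toNNReal ω)) with hF₁
  set F₂ : Ω → ℝ → ℝ := fun ω s =>
    (Real.exp (addFunctional k Z s ω) * k (Z s.toNNReal ω)) * martIncr b f Z s t ω with hF₂
  have i₁ : Integrable (Function.uncurry F₁) (μ.prod (volume.restrict (Set.Ioc 0 t))) := by
    refine hprod F₁ (E * (D + C * D)) ?_ fun ω s hs => ?_
    · exact hVm.mul ((hG.measurable.comp hYm).add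
        ((hk.measurable.comp hYm).mul (hfc.measurable.comp hYm)))
    · rw [hF₁, abs_mul, abs_of_pos (Real.exp_pos _)]
      refine mul_le_mul (hVE s hs ω) ((abs_add_le _ _).trans (add_le_add ?_ ?_)) (abs_nonneg _)
        hE0.le
      · exact (hD _ (hZ.pos _ ω).le).2
      · rw [abs_mul]
        exact mul_le_mul (hC _ (hZ.pos _ ω).le) (hD _ (hZ.pos _ ω).le).1 (abs_nonneg _) hC0
  have i₂ : Integrable (Function.uncurry F₂) (μ.prod (volume.restrict (Set.Ioc 0 t))) := by
    have hA : ∀ s ω, martIncr b f Z s t ω = f (Z t.toNNReal ω) - f (Z s.toNNReal ω) -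
        (addFunctional (genZ b f) Z t ω - addFunctional (genZ b f) Z s ω) := by
      intro s ω
      have := intervalIntegral.integral_interval_sub_left
        (hZ.intervalIntegrable_comp hG (fun x hx => (hD x hx).2) ω 0 t)
        (hZ.intervalIntegrable_comp hG (fun x hx => (hD x hx).2) ω 0 s)
      simp only [martIncr, addFunctional, this]
    have hAm := hZ.measurable_addFunctional hG (fun x hx => (hD x hx).2)
    have hmm : Measurable fun p : Ω × ℝ => martIncr b f Z p.2 t p.1 := by
      simp only [hA]
      exact (((hfc.measurable.comp (hZ.measurable _)).comp measurable_fst).sub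
        (hfc.measurable.comp hYm)).sub
        ((hAm.comp (measurable_const.prodMk measurable_fst)).sub (hAm.comp measurable_swap))
    refine hprod F₂ (E * C * (2 * D + D * t)) ?_ fun ω s hs => ?_
    · exact (hVm.mul (hk.measurable.comp hYm)).mul hmm
    · rw [hF₂, abs_mul, abs_mul, abs_of_pos (Real.exp_pos _)]
      refine mul_le_mul (mul_le_mul (hVE s hs ω) (hC _ (hZ.pos _ ω).le) (abs_nonneg _) hE0.le)
        ((hZ.abs_martIncr_le hD hs.2 ω).trans ?_) (abs_nonneg _) (by positivity)
      have := mul_nonneg hD0 hs.1.le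
      linarith
  have hz0 : ∫ ω, martIncr b f Z 0 t ω ∂μ = 0 := by
    simpa using hZ.integral_mul_martIncr hf le_rfl ht (V := fun _ => 1) measurable_const
      (B := 1) (by simp)
  have hz2 : ∫ ω, (∫ s in (0 : ℝ)..t, F₂ ω s) ∂μ = 0 := by
    simp only [intervalIntegral.integral_of_le ht]
    rw [integral_integral_swap i₂]
    refine setIntegral_eq_zero_of_forall_eq_zero fun s hs => ?_
    refine hZ.integral_mul_martIncr hf hs.1.le hs.2 (B := E * C) ?_ fun ω => ?_
    · exact (hZ.adapted_integral hk.measurable hs.1.le).exp.mul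
        (hk.measurable.comp (hZ.adapted _))
    · rw [abs_mul, abs_of_pos (Real.exp_pos _)]
      exact mul_le_mul (hVE s hs ω) (hC _ (hZ.pos _ ω).le) (abs_nonneg _) hE0.le
  have j0 : Integrable (fun ω => f (Z 0 ω)) μ :=
    integrable_of_measurable_of_abs_le (hfc.measurable.comp (hZ.measurable 0)) (C := D)
      fun ω => (hD _ (hZ.pos _ ω).le).1
  have j1 : Integrable (fun ω => ∫ s in (0 : ℝ)..t, F₁ ω s) μ := by
    simpa only [intervalIntegral.integral_of_le ht, Function.uncurry_apply_pair] using
      i₁.integral_prod_left (f := Function.uncurry F₁)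
  have j2 : Integrable (fun ω => martIncr b f Z 0 t ω) μ :=
    integrable_of_measurable_of_abs_le (hZ.measurable_martIncr hf.contDiff 0 t)
      fun ω => hZ.abs_martIncr_le hD ht ω
  have j3 : Integrable (fun ω => ∫ s in (0 : ℝ)..t, F₂ ω s) μ := by
    simpa only [intervalIntegral.integral_of_le ht, Function.uncurry_apply_pair] using
      i₂.integral_prod_left (f := Function.uncurry F₂)
  have hinit : ∫ ω, f (Z 0 ω) ∂μ = f 1 := by
    have : (fun ω => f (Z 0 ω)) =ᵐ[μ] fun _ => f 1 := by
      filter_upwards [hZ.init] with ω hω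
      rw [hω]
    rw [integral_congr_ae this]
    simp
  have j01 : Integrable (fun ω => f (Z 0 ω) + ∫ s in (0 : ℝ)..t, F₁ ω s) μ := j0.add j1
  have j012 : Integrable (fun ω => f (Z 0 ω) + (∫ s in (0 : ℝ)..t, F₁ ω s) +
    martIncr b f Z 0 t ω) μ := j01.add j2
  rw [integral_congr_ae (Eventually.of_forall fun ω => hZ.path_identity hf hk hC t ω),
    integral_add j012 j3, integral_add j01 j2, integral_add j0 j1, hinit, hz0, hz2, add_zero, add_zero]
  simp only [intervalIntegral.integral_of_le ht]
  rw [integral_integral_swap i₁]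

lemma measurable_integral_exp_addFunctional_mul [IsProbabilityMeasure μ]
    (hZ : IsProcessZ μ ℱ b Z) {k g : ℝ → ℝ} (hk : Continuous k) {C : ℝ}
    (hC : ∀ x, 0 ≤ x → |k x| ≤ C) (hg : Continuous g) :
    Measurable fun s : ℝ => ∫ ω, Real.exp (addFunctional k Z s ω) * g (Z s.toNNReal ω) ∂μ := by
  have h : StronglyMeasurable (Function.uncurry fun (s : ℝ) (ω : Ω) =>
      Real.exp (addFunctional k Z s ω) * g (Z s.toNNReal ω)) :=
    ((hZ.measurable_addFunctional hk hC).exp.mul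
      (hg.measurable.comp hZ.measurable_uncurry)).stronglyMeasurable
  exact h.integral_prod_right.measurable

end IsProcessZ

/-! ### Saturated exponentials -/

/-- The rate `κ(l) = b l - exp l + 1`, i.e. `-ψ(-l)`, for which `𝒢 (exp(l ·)) (x) = -κ(l) x exp(l x)`.
It increases on `[0, log b]`. -/
noncomputable def expRate (b l : ℝ) : ℝ := b * l - Real.exp l + 1

lemma expRate_mono {b l l' : ℝ} (hb : 1 < b) (h : l ≤ l') (h' : l' ≤ Real.log b) :
    expRate b l ≤ expRate b l' := by
  have h1 := Real.add_one_le_exp (-(l' - l))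
  have h2 : Real.exp l = Real.exp l' * Real.exp (-(l' - l)) := by
    rw [← Real.exp_add]; ring_nf
  have h3 : Real.exp l' ≤ b := (Real.le_log_iff_exp_le (by linarith)).1 h'
  have h4 := Real.exp_pos l'
  have h5 : Real.exp l' * (-(l' - l) + 1) ≤ Real.exp l := by
    rw [h2]; exact mul_le_mul_of_nonneg_left h1 h4.le
  unfold expRate
  nlinarith

lemma expRate_nonneg {b l : ℝ} (hb : 1 < b) (h : 0 ≤ l) (h' : l ≤ Real.log b) :
    0 ≤ expRate b l := by
  have := expRate_mono hb h h'
  simpa [expRate] using this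

lemma expRate_log {b : ℝ} (hb : 1 < b) :
    expRate b (Real.log b) = (Real.log b + b⁻¹ - 1) * b := by
  rw [expRate, Real.exp_log (by linarith)]
  field_simp
  ring

lemma log_pos_and_expRate_pos {b : ℝ} (hb : 1 < b) : 0 < Real.log b ∧ 0 < expRate b (Real.log b) := by
  have hb0 : 0 < b := by linarith
  refine ⟨Real.log_pos hb, ?_⟩
  have h := Real.log_lt_sub_one_of_pos (inv_pos.2 hb0) (by
    intro h; rw [inv_eq_one] at h; linarith)
  rw [Real.log_inv] at h
  rw [expRate_log hb]
  exact mul_pos (by linarith) hb0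

/-- The bounded concave function `y ↦ y / (1 + ε y)` of `y = exp(l x)`. -/
noncomputable def satExp (l ε x : ℝ) : ℝ := (Real.exp (-l * x) + ε)⁻¹

/-- The bounded potential paired with `satExp`: a damping of `κ x`. -/
noncomputable def satPot (l κ ε x : ℝ) : ℝ := κ * x / (1 + ε * Real.exp (l * x))

/-- The defect in the equation `𝒢 f + k f = 0` for the pair `satExp`, `satPot`. -/
noncomputable def satErr (l ε x : ℝ) : ℝ :=
  x * (ε * (Real.exp l - 1) ^ 2 * Real.exp (l * x) ^ 2 /
    ((1 + ε * Real.exp (l * x)) ^ 2 * (1 + ε * (Real.exp l * Real.exp (l * x)))))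

section

variable {b l ε κ x : ℝ}

lemma satExp_eq (hε : 0 < ε) : satExp l ε x = Real.exp (l * x) / (1 + ε * Real.exp (l * x)) := by
  have h : Real.exp (-l * x) = (Real.exp (l * x))⁻¹ := by rw [← Real.exp_neg]; ring_nf
  have := Real.exp_pos (l * x)
  rw [satExp, h]
  field_simp

lemma hasDerivAt_satExp (hε : 0 < ε) :
    HasDerivAt (satExp l ε) (l * Real.exp (-l * x) / (Real.exp (-l * x) + ε) ^ 2) x := by
  have h0 : Real.exp (-l * x) + ε ≠ 0 := by positivity
  have h := (((hasDerivAt_id x).const_mul (-l)).exp.add_const ε).inv h0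
  exact h.congr_deriv (by simp [mul_comm])

lemma isTest_satExp (hl : 0 < l) (hε : 0 < ε) : IsTest (satExp l ε) := by
  refine ⟨?_, 1 / ε, max 1 l * (1 + 1 / l) / ε ^ 2, fun x hx => ⟨?_, ?_⟩⟩
  · unfold satExp
    exact ContDiff.inv (by fun_prop) fun x => by positivity
  · have e1 : |satExp l ε x - 1 / ε| = Real.exp (-l * x) / (ε * (Real.exp (-l * x) + ε)) := by
      have : satExp l ε x - 1 / ε = -(Real.exp (-l * x) / (ε * (Real.exp (-l * x) + ε))) := by
        unfold satExp
        have : Real.exp (-l * x) + ε ≠ 0 := by positivity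
        field_simp
        ring
      rw [this, abs_neg, abs_of_nonneg (by positivity)]
    rw [e1, ← mul_div_assoc]
    have := Real.exp_pos (-l * x)
    refine div_le_div₀ (by positivity) ?_ (by positivity) (by nlinarith)
    exact (one_add_mul_exp_neg_le hl hx).trans (le_mul_of_one_le_left (by positivity) (le_max_left _ _))
  · rw [(hasDerivAt_satExp hε).deriv, abs_of_nonneg (by positivity), ← mul_div_assoc]
    have := Real.exp_pos (-l * x)
    refine div_le_div₀ (by positivity) ?_ (by positivity) (by nlinarith)
    calc (1 + x) * (l * Real.exp (-l * x)) = l * ((1 + x) * Real.exp (-l * x)) := by ring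
      _ ≤ max 1 l * (1 + 1 / l) :=
        mul_le_mul (le_max_right _ _) (one_add_mul_exp_neg_le hl hx) (by positivity) (by positivity)

lemma satExp_pos (hε : 0 < ε) : 0 < satExp l ε x := by
  unfold satExp; positivity

lemma satExp_le (hε : 0 < ε) : satExp l ε x ≤ Real.exp (l * x) := by
  rw [satExp_eq hε]
  have := Real.exp_pos (l * x)
  exact div_le_self this.le (by nlinarith)

lemma continuous_satPot (hε : 0 < ε) : Continuous (satPot l κ ε) := by
  unfold satPot
  exact Continuous.div (by fun_prop) (by fun_prop) fun x => by positivity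

lemma satPot_nonneg (hε : 0 < ε) (hκ : 0 ≤ κ) (hx : 0 ≤ x) : 0 ≤ satPot l κ ε x := by
  unfold satPot; positivity

lemma satPot_le (hε : 0 < ε) (hκ : 0 ≤ κ) (hx : 0 ≤ x) : satPot l κ ε x ≤ κ * x := by
  have := Real.exp_pos (l * x)
  exact div_le_self (by positivity) (by nlinarith)

lemma abs_satPot_le (hl : 0 < l) (hε : 0 < ε) (hκ : 0 ≤ κ) (hx : 0 ≤ x) :
    |satPot l κ ε x| ≤ κ / (l * ε) := by
  rw [abs_of_nonneg (satPot_nonneg hε hκ hx), satPot, div_le_div_iff₀ (by positivity) (by positivity)]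
  have h1 := Real.add_one_le_exp (l * x)
  have h2 : x * (l * ε) ≤ 1 + ε * Real.exp (l * x) := by nlinarith
  calc κ * x * (l * ε) = κ * (x * (l * ε)) := by ring
    _ ≤ κ * (1 + ε * Real.exp (l * x)) := mul_le_mul_of_nonneg_left h2 hκ

/-- By concavity of `y ↦ y / (1 + ε y)` the saturated exponential is a supersolution. -/
lemma genZ_satExp_add (hε : 0 < ε) :
    genZ b (satExp l ε) x + satPot l (expRate b l) ε x * satExp l ε x = -satErr l ε x := by
  have hy := Real.exp_pos (l * x)
  have h : Real.exp (-l * x) = (Real.exp (l * x))⁻¹ := by rw [← Real.exp_neg]; ring_nf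
  have h2 : Real.exp (l * (x + 1)) = Real.exp l * Real.exp (l * x) := by
    rw [← Real.exp_add]; ring_nf
  have ha := Real.exp_pos l
  rw [genZ, (hasDerivAt_satExp hε).deriv, satExp_eq hε, satExp_eq hε, satPot, satErr, expRate, h, h2]
  generalize Real.exp (l * x) = y at *
  generalize Real.exp l = a at *
  have h3 : 1 + ε * y ≠ 0 := by positivity
  have h4 : 1 + ε * (a * y) ≠ 0 := by positivity
  field_simp
  ring

lemma satErr_nonneg (hε : 0 < ε) (hx : 0 ≤ x) : 0 ≤ satErr l ε x := by
  unfold satErr; positivity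

lemma satErr_le_mul (hε : 0 < ε) (hx : 0 ≤ x) :
    satErr l ε x ≤ ε * (x * (Real.exp l - 1) ^ 2 * Real.exp (l * x) ^ 2) := by
  have hy := Real.exp_pos (l * x)
  have ha := Real.exp_pos l
  have h1 : ε * (Real.exp l - 1) ^ 2 * Real.exp (l * x) ^ 2 /
    ((1 + ε * Real.exp (l * x)) ^ 2 * (1 + ε * (Real.exp l * Real.exp (l * x)))) ≤
      ε * (Real.exp l - 1) ^ 2 * Real.exp (l * x) ^ 2 := by
    refine div_le_self (by positivity) ?_
    have e1 : 1 ≤ (1 + ε * Real.exp (l * x)) ^ 2 := one_le_pow₀ (by nlinarith)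
    have e2 : 0 < ε * (Real.exp l * Real.exp (l * x)) := by positivity
    nlinarith
  calc satErr l ε x ≤ x * (ε * (Real.exp l - 1) ^ 2 * Real.exp (l * x) ^ 2) :=
        mul_le_mul_of_nonneg_left h1 hx
    _ = _ := by ring

lemma satErr_le (hε : 0 < ε) (hx : 0 ≤ x) :
    satErr l ε x ≤ (Real.exp l - 1) ^ 2 * (x * Real.exp (l * x)) := by
  have hy := Real.exp_pos (l * x)
  have ha := Real.exp_pos l
  have h1 : ε * (Real.exp l - 1) ^ 2 * Real.exp (l * x) ^ 2 /
    ((1 + ε * Real.exp (l * x)) ^ 2 * (1 + ε * (Real.exp l * Real.exp (l * x)))) ≤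
      (Real.exp l - 1) ^ 2 * Real.exp (l * x) := by
    rw [div_le_iff₀ (by positivity)]
    have e1 : ε * Real.exp (l * x) ≤ (1 + ε * Real.exp (l * x)) ^ 2 := by nlinarith
    have e2 : 0 < ε * (Real.exp l * Real.exp (l * x)) := by positivity
    have e3 : ε * Real.exp (l * x) ≤
        (1 + ε * Real.exp (l * x)) ^ 2 * (1 + ε * (Real.exp l * Real.exp (l * x))) := by nlinarith
    have e4 : 0 ≤ (Real.exp l - 1) ^ 2 * Real.exp (l * x) := by positivity
    calc _ = (Real.exp l - 1) ^ 2 * Real.exp (l * x) * (ε * Real.exp (l * x)) := by ring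
      _ ≤ _ := mul_le_mul_of_nonneg_left e3 e4
  calc satErr l ε x ≤ x * ((Real.exp l - 1) ^ 2 * Real.exp (l * x)) :=
        mul_le_mul_of_nonneg_left h1 hx
    _ = _ := by ring

lemma continuous_satErr (hε : 0 < ε) : Continuous (satErr l ε) := by
  unfold satErr
  exact continuous_id.mul (Continuous.div (by fun_prop) (by fun_prop) fun x => by positivity)

end

/-- The parameters `ε = 1 / (n + 1)` along which the saturation is removed. -/
noncomputable def satSeq (n : ℕ) : ℝ := 1 / ((n : ℝ) + 1)

lemma satSeq_pos (n : ℕ) : 0 < satSeq n := by unfold satSeq; positivity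

lemma tendsto_satSeq : Tendsto satSeq atTop (𝓝 0) := tendsto_one_div_add_atTop_nhds_zero_nat

lemma tendsto_satExp (l x : ℝ) :
    Tendsto (fun n => satExp l (satSeq n) x) atTop (𝓝 (Real.exp (l * x))) := by
  have h := (tendsto_satSeq.const_add (Real.exp (-l * x))).inv₀ (by positivity)
  rw [add_zero, ← Real.exp_neg] at h
  simpa [satExp] using h

lemma tendsto_satPot (l κ x : ℝ) :
    Tendsto (fun n => satPot l κ (satSeq n) x) atTop (𝓝 (κ * x)) := by
  have h := (tendsto_const_nhds (x := κ * x)).div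
    ((tendsto_satSeq.mul_const (Real.exp (l * x))).const_add 1) (by simp)
  rw [zero_mul, add_zero, div_one] at h
  exact h

lemma tendsto_satErr (l : ℝ) {x : ℝ} (hx : 0 ≤ x) :
    Tendsto (fun n => satErr l (satSeq n) x) atTop (𝓝 0) := by
  have h := tendsto_satSeq.mul_const (x * (Real.exp l - 1) ^ 2 * Real.exp (l * x) ^ 2)
  rw [zero_mul] at h
  exact squeeze_zero (fun n => satErr_nonneg (satSeq_pos n) hx)
    (fun n => satErr_le_mul (satSeq_pos n) hx) h

/-! ### Exponential moments of the process and its time integral -/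

namespace IsProcessZ

variable {Ω : Type*} {m : MeasurableSpace Ω} {μ : Measure Ω} {ℱ : Filtration ℝ≥0 m} {b : ℝ}
  {Z : ℝ≥0 → Ω → ℝ}

lemma intervalIntegrable_path (hZ : IsProcessZ μ ℱ b Z) (hb : 1 < b) {ω : Ω}
    (hω : ∀ s t : ℝ, 0 ≤ s → s ≤ t →
      Real.exp (b * s) * Z s.toNNReal ω ≤ Real.exp (b * t) * Z t.toNNReal ω) {s t : ℝ}
    (hs : 0 ≤ s) (ht : 0 ≤ t) :
    IntervalIntegrable (fun r : ℝ => Z r.toNNReal ω) volume s t := by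
  set T := max s t with hT
  refine (intervalIntegrable_const (c := Real.exp (b * T) * Z T.toNNReal ω)).mono_fun
    (hZ.measurable_path ω).aestronglyMeasurable ?_
  filter_upwards [ae_restrict_mem measurableSet_uIoc] with r hr
  have hr0 : 0 ≤ r := (le_min hs ht).trans hr.1.le
  have h1 := hω r T hr0 hr.2
  have h2 := hZ.pos r.toNNReal ω
  have h3 : 1 ≤ Real.exp (b * r) := Real.one_le_exp (by nlinarith)
  rw [Real.norm_of_nonneg h2.le]
  exact ((le_mul_of_one_le_left h2.le h3).trans h1).trans (le_abs_self _)

lemma addFunctional_satPot_le (hZ : IsProcessZ μ ℱ b Z) (hb : 1 < b) {ω : Ω}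
    (hω : ∀ s t : ℝ, 0 ≤ s → s ≤ t →
      Real.exp (b * s) * Z s.toNNReal ω ≤ Real.exp (b * t) * Z t.toNNReal ω) {l κ ε t : ℝ}
    (hl : 0 < l) (hκ : 0 ≤ κ) (hε : 0 < ε) (ht : 0 ≤ t) :
    addFunctional (satPot l κ ε) Z t ω ≤ κ * addFunctional (fun x => x) Z t ω := by
  unfold addFunctional
  rw [← intervalIntegral.integral_const_mul]
  exact intervalIntegral.integral_mono_on ht
    (hZ.intervalIntegrable_comp (continuous_satPot hε) (fun x hx => abs_satPot_le hl hε hκ hx) ω 0 t)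
    ((hZ.intervalIntegrable_path hb hω le_rfl ht).const_mul κ)
    (fun r _ => satPot_le hε hκ (hZ.pos _ ω).le)

lemma tendsto_addFunctional_satPot (hZ : IsProcessZ μ ℱ b Z) (hb : 1 < b) {ω : Ω}
    (hω : ∀ s t : ℝ, 0 ≤ s → s ≤ t →
      Real.exp (b * s) * Z s.toNNReal ω ≤ Real.exp (b * t) * Z t.toNNReal ω) {l κ t : ℝ}
    (hκ : 0 ≤ κ) (ht : 0 ≤ t) :
    Tendsto (fun n => addFunctional (satPot l κ (satSeq n)) Z t ω) atTop
      (𝓝 (κ * addFunctional (fun x => x) Z t ω)) := by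
  unfold addFunctional
  rw [← intervalIntegral.integral_const_mul]
  refine intervalIntegral.tendsto_integral_filter_of_dominated_convergence
    (fun r => κ * Z r.toNNReal ω) (Eventually.of_forall fun n => ?_)
    (Eventually.of_forall fun n => Eventually.of_forall fun r _ => ?_)
    ((hZ.intervalIntegrable_path hb hω le_rfl ht).const_mul κ)
    (Eventually.of_forall fun r _ => tendsto_satPot l κ _)
  · exact ((continuous_satPot (satSeq_pos n)).measurable.comp
      (hZ.measurable_path ω)).aestronglyMeasurable
  · rw [Real.norm_of_nonneg (satPot_nonneg (satSeq_pos n) hκ (hZ.pos _ ω).le)]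
    exact satPot_le (satSeq_pos n) hκ (hZ.pos _ ω).le

lemma measurable_exp_addFunctional (hZ : IsProcessZ μ ℱ b Z) (l κ t : ℝ) :
    Measurable fun ω => Real.exp (l * Z t.toNNReal ω + κ * addFunctional (fun x => x) Z t ω) :=
  (((hZ.measurable _).const_mul l).add
    ((hZ.measurable_integral measurable_id 0 t).const_mul κ)).exp

/-- The Feynman–Kac formula for the saturated exponential. -/
lemma integral_satExp [IsProbabilityMeasure μ] (hZ : IsProcessZ μ ℱ b Z) {l ε t : ℝ} (hl : 0 < l)
    (hκ : 0 ≤ expRate b l) (hε : 0 < ε) (ht : 0 ≤ t) :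
    ∫ ω, satExp l ε (Z t.toNNReal ω) *
        Real.exp (addFunctional (satPot l (expRate b l) ε) Z t ω) ∂μ =
      satExp l ε 1 - ∫ s in (0 : ℝ)..t, (∫ ω,
        Real.exp (addFunctional (satPot l (expRate b l) ε) Z s ω) *
          satErr l ε (Z s.toNNReal ω) ∂μ) := by
  rw [hZ.feynmanKac (isTest_satExp hl hε) (continuous_satPot hε)
    (fun x hx => abs_satPot_le hl hε hκ hx) ht]
  simp only [genZ_satExp_add hε, mul_neg, integral_neg, intervalIntegral.integral_neg]
  ring

lemma integrable_satExp [IsProbabilityMeasure μ] (hZ : IsProcessZ μ ℱ b Z) {l κ ε t : ℝ}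
    (hl : 0 < l) (hκ : 0 ≤ κ) (hε : 0 < ε) (ht : 0 ≤ t) :
    Integrable (fun ω => satExp l ε (Z t.toNNReal ω) *
        Real.exp (addFunctional (satPot l κ ε) Z t ω)) μ := by
  obtain ⟨D, hD⟩ := (isTest_satExp hl hε).exists_bound b
  refine integrable_of_measurable_of_abs_le (C := D * Real.exp (κ / (l * ε) * t)) ?_ fun ω => ?_
  · exact ((isTest_satExp hl hε).contDiff.continuous.measurable.comp (hZ.measurable _)).mul
      (hZ.measurable_integral (continuous_satPot hε).measurable 0 t).exp
  · rw [abs_mul, abs_of_pos (Real.exp_pos _)]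
    have h := (hD _ (hZ.pos t.toNNReal ω).le).1
    exact mul_le_mul h (Real.exp_le_exp.2
      (hZ.addFunctional_le (fun x hx => abs_satPot_le hl hε hκ hx) ht ω)) (Real.exp_pos _).le
      ((abs_nonneg _).trans h)

/-- The supermartingale bound for the exponential functional, by Fatou's lemma from its saturated
versions. -/
lemma lintegral_exp_le [IsProbabilityMeasure μ] (hZ : IsProcessZ μ ℱ b Z) (hb : 1 < b) {l t : ℝ}
    (hl : 0 < l) (hκ : 0 ≤ expRate b l) (ht : 0 ≤ t) :
    ∫⁻ ω, ENNReal.ofReal (Real.exp (l * Z t.toNNReal ω +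
      expRate b l * addFunctional (fun x => x) Z t ω)) ∂μ ≤ ENNReal.ofReal (Real.exp l) := by
  set F : ℕ → Ω → ℝ := fun n ω => satExp l (satSeq n) (Z t.toNNReal ω) *
    Real.exp (addFunctional (satPot l (expRate b l) (satSeq n)) Z t ω) with hF
  have hFi : ∀ n, Integrable (F n) μ := fun n => hZ.integrable_satExp hl hκ (satSeq_pos n) ht
  have hFm : ∀ n, Measurable (F n) := fun n =>
    ((isTest_satExp hl (satSeq_pos n)).contDiff.continuous.measurable.comp (hZ.measurable _)).mul
      (hZ.measurable_integral (continuous_satPot (satSeq_pos n)).measurable 0 t).exp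
  have hF0 : ∀ n ω, 0 ≤ F n ω := fun n ω =>
    mul_nonneg (satExp_pos (satSeq_pos n)).le (Real.exp_pos _).le
  have hbound : ∀ n, ∫⁻ ω, ENNReal.ofReal (F n ω) ∂μ ≤ ENNReal.ofReal (Real.exp l) := by
    intro n
    rw [← ofReal_integral_eq_lintegral_ofReal (hFi n) (Eventually.of_forall (hF0 n))]
    refine ENNReal.ofReal_le_ofReal ?_
    rw [hF, hZ.integral_satExp hl hκ (satSeq_pos n) ht]
    have h1 : satExp l (satSeq n) 1 ≤ Real.exp l := by
      simpa using satExp_le (l := l) (x := 1) (satSeq_pos n)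
    have h2 : 0 ≤ ∫ s in (0 : ℝ)..t, (∫ ω,
        Real.exp (addFunctional (satPot l (expRate b l) (satSeq n)) Z s ω) *
          satErr l (satSeq n) (Z s.toNNReal ω) ∂μ) :=
      intervalIntegral.integral_nonneg ht fun s _ => integral_nonneg fun ω =>
        mul_nonneg (Real.exp_pos _).le (satErr_nonneg (satSeq_pos n) (hZ.pos _ ω).le)
    linarith
  calc _ = ∫⁻ ω, liminf (fun n => ENNReal.ofReal (F n ω)) atTop ∂μ := by
        refine lintegral_congr_ae ?_
        filter_upwards [hZ.ae_exp_mul_mono hb] with ω hω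
        refine (Tendsto.liminf_eq ?_).symm
        refine (ENNReal.continuous_ofReal.tendsto _).comp ?_
        rw [Real.exp_add]
        exact (tendsto_satExp l _).mul ((Real.continuous_exp.tendsto _).comp
          (hZ.tendsto_addFunctional_satPot hb hω hκ ht))
    _ ≤ liminf (fun n => ∫⁻ ω, ENNReal.ofReal (F n ω) ∂μ) atTop :=
        lintegral_liminf_le fun n => (hFm n).ennreal_ofReal
    _ ≤ ENNReal.ofReal (Real.exp l) := by
        refine (liminf_le_liminf (Eventually.of_forall hbound)).trans ?_
        simp

lemma integrable_exp [IsProbabilityMeasure μ] (hZ : IsProcessZ μ ℱ b Z) (hb : 1 < b) {l t : ℝ}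
    (hl : 0 < l) (hκ : 0 ≤ expRate b l) (ht : 0 ≤ t) :
    Integrable (fun ω => Real.exp (l * Z t.toNNReal ω +
      expRate b l * addFunctional (fun x => x) Z t ω)) μ := by
  refine ⟨(hZ.measurable_exp_addFunctional l _ t).aestronglyMeasurable, ?_⟩
  rw [hasFiniteIntegral_iff_ofReal (Eventually.of_forall fun ω => (Real.exp_pos _).le)]
  exact (hZ.lintegral_exp_le hb hl hκ ht).trans_lt ENNReal.ofReal_lt_top

lemma integral_exp_le [IsProbabilityMeasure μ] (hZ : IsProcessZ μ ℱ b Z) (hb : 1 < b) {l t : ℝ}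
    (hl : 0 < l) (hκ : 0 ≤ expRate b l) (ht : 0 ≤ t) :
    ∫ ω, Real.exp (l * Z t.toNNReal ω + expRate b l * addFunctional (fun x => x) Z t ω) ∂μ ≤
      Real.exp l := by
  have h := hZ.lintegral_exp_le hb hl hκ ht
  rwa [← ofReal_integral_eq_lintegral_ofReal (hZ.integrable_exp hb hl hκ ht)
    (Eventually.of_forall fun ω => (Real.exp_pos _).le),
    ENNReal.ofReal_le_ofReal_iff (Real.exp_pos _).le] at h

/-- Strictly below the critical exponent `log b` the supermartingale is a true martingale: its
defect is dominated by the exponential functional with a larger exponent. -/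
theorem integral_exp_eq [IsProbabilityMeasure μ] (hZ : IsProcessZ μ ℱ b Z) (hb : 1 < b) {l t : ℝ}
    (hl : 0 < l) (hlb : l < Real.log b) (ht : 0 ≤ t) :
    ∫ ω, Real.exp (l * Z t.toNNReal ω + expRate b l * addFunctional (fun x => x) Z t ω) ∂μ =
      Real.exp l := by
  have hκ := expRate_nonneg hb hl.le hlb.le
  set L := Real.log b with hL
  have hL0 : 0 < L := hl.trans hlb
  have hκL := expRate_nonneg hb hL0.le hL.le
  have hκκ : expRate b l ≤ expRate b L := expRate_mono hb hlb.le le_rfl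
  have hI0 : ∀ s, 0 ≤ s → ∀ ω, 0 ≤ addFunctional (fun x => x) Z s ω := fun s hs ω =>
    intervalIntegral.integral_nonneg hs fun r _ => (hZ.pos _ ω).le
  set K := (Real.exp l - 1) ^ 2 * (1 / (L - l)) with hK
  have hLl : 0 < L - l := sub_pos.2 hlb
  have hK0 : 0 ≤ K := by positivity
  set e : ℕ → ℝ → Ω → ℝ := fun n s ω =>
    Real.exp (addFunctional (satPot l (expRate b l) (satSeq n)) Z s ω) *
      satErr l (satSeq n) (Z s.toNNReal ω) with he
  have he0 : ∀ n s ω, 0 ≤ e n s ω := fun n s ω =>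
    mul_nonneg (Real.exp_pos _).le (satErr_nonneg (satSeq_pos n) (hZ.pos _ ω).le)
  have hedom : ∀ n s, 0 ≤ s → ∀ᵐ ω ∂μ, ‖e n s ω‖ ≤ K * Real.exp (L * Z s.toNNReal ω +
      expRate b L * addFunctional (fun x => x) Z s ω) := by
    intro n s hs
    filter_upwards [hZ.ae_exp_mul_mono hb] with ω hω
    rw [Real.norm_of_nonneg (he0 n s ω)]
    have hx := (hZ.pos s.toNNReal ω).le
    have h1 : Real.exp (addFunctional (satPot l (expRate b l) (satSeq n)) Z s ω) ≤
        Real.exp (expRate b L * addFunctional (fun x => x) Z s ω) :=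
      Real.exp_le_exp.2 ((hZ.addFunctional_satPot_le hb hω hl hκ (satSeq_pos n) hs).trans
        (mul_le_mul_of_nonneg_right hκκ (hI0 s hs ω)))
    have h2 : satErr l (satSeq n) (Z s.toNNReal ω) ≤ K * Real.exp (L * Z s.toNNReal ω) := by
      refine (satErr_le (satSeq_pos n) hx).trans ?_
      rw [hK, mul_assoc]
      refine mul_le_mul_of_nonneg_left ?_ (by positivity)
      have h3 := mul_exp_neg_le hLl (Z s.toNNReal ω)
      have h4 : Real.exp (l * Z s.toNNReal ω) = Real.exp (-(L - l) * Z s.toNNReal ω) *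
          Real.exp (L * Z s.toNNReal ω) := by
        rw [← Real.exp_add]; ring_nf
      rw [h4, ← mul_assoc]
      exact mul_le_mul_of_nonneg_right h3 (Real.exp_pos _).le
    rw [Real.exp_add]
    calc e n s ω ≤ Real.exp (expRate b L * addFunctional (fun x => x) Z s ω) *
          (K * Real.exp (L * Z s.toNNReal ω)) :=
          mul_le_mul h1 h2 (satErr_nonneg (satSeq_pos n) hx) (Real.exp_pos _).le
      _ = _ := by ring
  have hem : ∀ n s, Measurable (e n s) := fun n s =>
    (hZ.measurable_integral (continuous_satPot (satSeq_pos n)).measurable 0 s).exp.mul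
      ((continuous_satErr (satSeq_pos n)).measurable.comp (hZ.measurable _))
  have hdomint : ∀ s, 0 ≤ s → Integrable (fun ω => K * Real.exp (L * Z s.toNNReal ω +
      expRate b L * addFunctional (fun x => x) Z s ω)) μ := fun s hs =>
    (hZ.integrable_exp hb hL0 hκL hs).const_mul K
  have hEe : ∀ n s, 0 ≤ s → ∫ ω, e n s ω ∂μ ≤ K * Real.exp L := by
    intro n s hs
    calc ∫ ω, e n s ω ∂μ ≤ ∫ ω, K * Real.exp (L * Z s.toNNReal ω +
          expRate b L * addFunctional (fun x => x) Z s ω) ∂μ := by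
          refine integral_mono_ae ((hdomint s hs).mono' (hem n s).aestronglyMeasurable
            (hedom n s hs)) (hdomint s hs) ?_
          filter_upwards [hedom n s hs] with ω hω using (le_abs_self _).trans hω
      _ ≤ K * Real.exp L := by
          rw [integral_const_mul]
          exact mul_le_mul_of_nonneg_left (hZ.integral_exp_le hb hL0 hκL hs) hK0
  have herr : Tendsto (fun n => ∫ s in (0 : ℝ)..t, (∫ ω, e n s ω ∂μ)) atTop (𝓝 0) := by
    have := intervalIntegral.tendsto_integral_filter_of_dominated_convergence (a := 0) (b := t)
      (μ := volume) (l := atTop) (F := fun n s => ∫ ω, e n s ω ∂μ) (f := fun _ => 0)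
      (fun _ => K * Real.exp L) (Eventually.of_forall fun n => ?_)
      (Eventually.of_forall fun n => Eventually.of_forall fun s hs => ?_) intervalIntegrable_const
      (Eventually.of_forall fun s hs => ?_)
    · simpa using this
    · exact (hZ.measurable_integral_exp_addFunctional_mul (continuous_satPot (satSeq_pos n))
        (fun x hx => abs_satPot_le hl (satSeq_pos n) hκ hx)
        (continuous_satErr (satSeq_pos n))).aestronglyMeasurable
    · rw [Set.uIoc_of_le ht] at hs
      rw [Real.norm_of_nonneg (integral_nonneg (he0 n s))]
      exact hEe n s hs.1.le
    · rw [Set.uIoc_of_le ht] at hs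
      have := tendsto_integral_of_dominated_convergence (F := fun n ω => e n s ω) (f := fun _ => 0)
        _ (fun n => (hem n s).aestronglyMeasurable) (hdomint s hs.1.le)
        (fun n => hedom n s hs.1.le) ?_
      · simpa using this
      · filter_upwards [hZ.ae_exp_mul_mono hb] with ω hω
        have h1 := ((Real.continuous_exp.tendsto _).comp
          (hZ.tendsto_addFunctional_satPot (l := l) hb hω hκ hs.1.le)).mul
          (tendsto_satErr l (hZ.pos s.toNNReal ω).le)
        rwa [mul_zero] at h1
  have hlhs : Tendsto (fun n => ∫ ω, satExp l (satSeq n) (Z t.toNNReal ω) *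
      Real.exp (addFunctional (satPot l (expRate b l) (satSeq n)) Z t ω) ∂μ) atTop
      (𝓝 (∫ ω, Real.exp (l * Z t.toNNReal ω +
        expRate b l * addFunctional (fun x => x) Z t ω) ∂μ)) := by
    refine tendsto_integral_of_dominated_convergence _
      (fun n => (hZ.integrable_satExp hl hκ (satSeq_pos n) ht).aestronglyMeasurable)
      (hZ.integrable_exp hb hl hκ ht) (fun n => ?_) ?_
    · filter_upwards [hZ.ae_exp_mul_mono hb] with ω hω
      rw [Real.norm_of_nonneg (mul_nonneg (satExp_pos (satSeq_pos n)).le (Real.exp_pos _).le),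
        Real.exp_add]
      exact mul_le_mul (satExp_le (satSeq_pos n)) (Real.exp_le_exp.2
        (hZ.addFunctional_satPot_le hb hω hl hκ (satSeq_pos n) ht)) (Real.exp_pos _).le
        (Real.exp_pos _).le
    · filter_upwards [hZ.ae_exp_mul_mono hb] with ω hω
      rw [Real.exp_add]
      exact (tendsto_satExp l _).mul ((Real.continuous_exp.tendsto _).comp
          (hZ.tendsto_addFunctional_satPot hb hω hκ ht))
  have hrhs := (tendsto_satExp l 1).sub herr
  simp only [hZ.integral_satExp hl hκ (satSeq_pos _) ht] at hlhs
  rw [mul_one, sub_zero] at hrhs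
  exact tendsto_nhds_unique hlhs hrhs

/-! ### Extinction and the total integral -/

/-- Integrability of almost every path, from the exponential moment bound and Fatou's lemma. -/
theorem ae_integrableOn [IsProbabilityMeasure μ] (hZ : IsProcessZ μ ℱ b Z) (hb : 1 < b) :
    ∀ᵐ ω ∂μ, IntegrableOn (fun s : ℝ => Z s.toNNReal ω) (Set.Ioi 0) := by
  obtain ⟨hL, hκ⟩ := log_pos_and_expRate_pos hb
  set L := Real.log b
  set M : ℕ → Ω → ℝ≥0∞ := fun n ω => ENNReal.ofReal (Real.exp (L * Z (n : ℝ).toNNReal ω +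
    expRate b L * addFunctional (fun x => x) Z n ω)) with hM
  have hMm : ∀ n, Measurable (M n) := fun n =>
    (hZ.measurable_exp_addFunctional L _ n).ennreal_ofReal
  have hfin : ∫⁻ ω, liminf (fun n => M n ω) atTop ∂μ ≠ ∞ := by
    refine ne_top_of_le_ne_top (ENNReal.ofReal_ne_top (r := Real.exp L))
      ((lintegral_liminf_le hMm).trans ?_)
    refine (liminf_le_liminf (Eventually.of_forall fun n =>
      hZ.lintegral_exp_le hb hL hκ.le n.cast_nonneg)).trans ?_
    simp
  filter_upwards [ae_lt_top (Measurable.liminf hMm) hfin, hZ.ae_exp_mul_mono hb] with ω h1 hω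
  have hpos : ∀ s : ℝ, 0 ≤ Z s.toNNReal ω := fun s => (hZ.pos _ ω).le
  have hint : ∀ n : ℕ, IntervalIntegrable (fun s : ℝ => Z s.toNNReal ω) volume 0 n := fun n =>
    hZ.intervalIntegrable_path hb hω le_rfl n.cast_nonneg
  have hmono : Monotone fun n : ℕ => addFunctional (fun x => x) Z n ω := by
    intro p q hpq
    have hpq' : (p : ℝ) ≤ q := by exact_mod_cast hpq
    exact intervalIntegral.integral_mono_interval le_rfl p.cast_nonneg hpq'
      (Eventually.of_forall hpos) (hint q)
  rcases tendsto_atTop_of_monotone hmono with h | ⟨l, hl⟩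
  · exfalso
    have : Tendsto (fun n => M n ω) atTop (𝓝 ∞) := by
      refine ENNReal.tendsto_ofReal_atTop.comp (Real.tendsto_exp_atTop.comp ?_)
      refine tendsto_atTop_mono (fun n => ?_) (h.const_mul_atTop hκ)
      have := mul_nonneg hL.le (hpos n)
      linarith
    rw [this.liminf_eq] at h1
    exact lt_irrefl _ h1
  · refine integrableOn_Ioi_of_intervalIntegral_norm_tendsto l 0 (b := fun n : ℕ => (n : ℝ))
      (fun n => (intervalIntegrable_iff_integrableOn_Ioc_of_le n.cast_nonneg).1 (hint n))
      tendsto_natCast_atTop_atTop ?_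
    refine hl.congr fun n => intervalIntegral.integral_congr fun s _ => ?_
    exact (Real.norm_of_nonneg (hpos s)).symm

lemma tendsto_addFunctional {ω : Ω}
    (hint : IntegrableOn (fun s : ℝ => Z s.toNNReal ω) (Set.Ioi 0)) :
    Tendsto (fun t => addFunctional (fun x => x) Z t ω) atTop
      (𝓝 (∫ s in Set.Ioi (0 : ℝ), Z s.toNNReal ω)) :=
  intervalIntegral_tendsto_integral_Ioi 0 hint tendsto_id

/-- An integrable path whose product with `exp(b t)` is nondecreasing vanishes at infinity, since
`Z t ≤ exp(b) ∫_t^(t+1) Z`. -/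
lemma tendsto_path_zero (hZ : IsProcessZ μ ℱ b Z) (hb : 1 < b) {ω : Ω}
    (hω : ∀ s t : ℝ, 0 ≤ s → s ≤ t →
      Real.exp (b * s) * Z s.toNNReal ω ≤ Real.exp (b * t) * Z t.toNNReal ω)
    (hint : IntegrableOn (fun s : ℝ => Z s.toNNReal ω) (Set.Ioi 0)) :
    Tendsto (fun t : ℝ => Z t.toNNReal ω) atTop (𝓝 0) := by
  have hlim := tendsto_addFunctional hint
  have hdiff := ((hlim.comp (tendsto_atTop_add_const_right atTop (1 : ℝ) tendsto_id)).sub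
    hlim).const_mul (Real.exp b)
  rw [sub_self, mul_zero] at hdiff
  refine tendsto_of_tendsto_of_tendsto_of_le_of_le' tendsto_const_nhds hdiff
    (Eventually.of_forall fun t => (hZ.pos _ ω).le) ?_
  filter_upwards [eventually_ge_atTop 0] with t ht
  have ht1 : 0 ≤ t + 1 := by linarith
  have hI := fun s r hs hr => hZ.intervalIntegrable_path hb hω (s := s) (t := r) hs hr
  have e1 : addFunctional (fun x => x) Z (t + 1) ω - addFunctional (fun x => x) Z t ω =
      ∫ s in t..(t + 1), Z s.toNNReal ω :=
    intervalIntegral.integral_interval_sub_left (hI 0 (t + 1) le_rfl ht1) (hI 0 t le_rfl ht)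
  have e2 : ∫ _ in t..(t + 1), Real.exp (-b) * Z t.toNNReal ω ≤
      ∫ s in t..(t + 1), Z s.toNNReal ω := by
    refine intervalIntegral.integral_mono_on (by linarith) intervalIntegrable_const
      (hI t (t + 1) ht ht1) fun s hs => ?_
    have h1 := hω t s ht hs.1
    have h2 : Real.exp (-b) * Real.exp (b * s) ≤ Real.exp (b * t) := by
      rw [← Real.exp_add, Real.exp_le_exp]
      nlinarith [hs.2]
    have h3 := Real.exp_pos (b * s)
    have h4 := (hZ.pos t.toNNReal ω).le
    refine le_of_mul_le_mul_left ?_ h3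
    calc Real.exp (b * s) * (Real.exp (-b) * Z t.toNNReal ω)
        = (Real.exp (-b) * Real.exp (b * s)) * Z t.toNNReal ω := by ring
      _ ≤ Real.exp (b * t) * Z t.toNNReal ω := mul_le_mul_of_nonneg_right h2 h4
      _ ≤ _ := h1
  rw [intervalIntegral.integral_const, add_sub_cancel_left, one_smul] at e2
  simp only [Function.comp_apply, id]
  rw [e1]
  calc Z t.toNNReal ω = Real.exp b * (Real.exp (-b) * Z t.toNNReal ω) := by
        rw [← mul_assoc, ← Real.exp_add]; simp
    _ ≤ _ := mul_le_mul_of_nonneg_left e2 (Real.exp_pos b).le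

theorem ae_tendsto_zero [IsProbabilityMeasure μ] (hZ : IsProcessZ μ ℱ b Z) (hb : 1 < b) :
    ∀ᵐ ω ∂μ, Tendsto (fun t => Z t ω) atTop (𝓝 0) := by
  filter_upwards [hZ.ae_exp_mul_mono hb, hZ.ae_integrableOn hb] with ω hω hint
  have h := (hZ.tendsto_path_zero hb hω hint).comp (NNReal.tendsto_coe_atTop.2 tendsto_id)
  simpa [Function.comp_def] using h

lemma measurable_integral_Ioi (hZ : IsProcessZ μ ℱ b Z) :
    Measurable fun ω => ∫ s in Set.Ioi (0 : ℝ), Z s.toNNReal ω := by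
  have h : StronglyMeasurable (Function.uncurry fun (ω : Ω) (s : ℝ) => Z s.toNNReal ω) :=
    (hZ.measurable_uncurry.comp measurable_swap).stronglyMeasurable
  exact h.integral_prod_right.measurable

lemma tendsto_exp_functional (hZ : IsProcessZ μ ℱ b Z) (hb : 1 < b) {ω : Ω}
    (hω : ∀ s t : ℝ, 0 ≤ s → s ≤ t →
      Real.exp (b * s) * Z s.toNNReal ω ≤ Real.exp (b * t) * Z t.toNNReal ω)
    (hint : IntegrableOn (fun s : ℝ => Z s.toNNReal ω) (Set.Ioi 0)) (l κ : ℝ) :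
    Tendsto (fun n : ℕ => Real.exp (l * Z (n : ℝ).toNNReal ω +
      κ * addFunctional (fun x => x) Z n ω)) atTop
      (𝓝 (Real.exp (κ * ∫ s in Set.Ioi (0 : ℝ), Z s.toNNReal ω))) := by
  have h := ((hZ.tendsto_path_zero hb hω hint).const_mul l).add
    ((tendsto_addFunctional hint).const_mul κ)
  rw [mul_zero, zero_add] at h
  exact ((Real.continuous_exp.tendsto _).comp h).comp tendsto_natCast_atTop_atTop

/-- Upper bound for the exponential moment of the total integral, including the critical exponent
`l = log b`. -/
lemma integral_exp_total_le [IsProbabilityMeasure μ] (hZ : IsProcessZ μ ℱ b Z) (hb : 1 < b)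
    {l : ℝ} (hl : 0 < l) (hκ : 0 ≤ expRate b l) :
    Integrable (fun ω => Real.exp (expRate b l * ∫ s in Set.Ioi (0 : ℝ), Z s.toNNReal ω)) μ ∧
    ∫ ω, Real.exp (expRate b l * ∫ s in Set.Ioi (0 : ℝ), Z s.toNNReal ω) ∂μ ≤ Real.exp l := by
  have hm : Measurable fun ω =>
      Real.exp (expRate b l * ∫ s in Set.Ioi (0 : ℝ), Z s.toNNReal ω) :=
    (hZ.measurable_integral_Ioi.const_mul _).exp
  have hle : ∫⁻ ω, ENNReal.ofReal (Real.exp (expRate b l *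
      ∫ s in Set.Ioi (0 : ℝ), Z s.toNNReal ω)) ∂μ ≤ ENNReal.ofReal (Real.exp l) := by
    calc _ = ∫⁻ ω, liminf (fun n : ℕ => ENNReal.ofReal (Real.exp (l * Z (n : ℝ).toNNReal ω +
          expRate b l * addFunctional (fun x => x) Z n ω))) atTop ∂μ := by
          refine lintegral_congr_ae ?_
          filter_upwards [hZ.ae_exp_mul_mono hb, hZ.ae_integrableOn hb] with ω hω hint
          exact ((ENNReal.continuous_ofReal.tendsto _).comp
            (hZ.tendsto_exp_functional hb hω hint l _)).liminf_eq.symm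
      _ ≤ liminf (fun n : ℕ => ∫⁻ ω, ENNReal.ofReal (Real.exp (l * Z (n : ℝ).toNNReal ω +
          expRate b l * addFunctional (fun x => x) Z n ω)) ∂μ) atTop :=
          lintegral_liminf_le fun n => (hZ.measurable_exp_addFunctional l _ n).ennreal_ofReal
      _ ≤ ENNReal.ofReal (Real.exp l) := by
          refine (liminf_le_liminf (Eventually.of_forall fun n =>
            hZ.lintegral_exp_le hb hl hκ n.cast_nonneg)).trans ?_
          simp
  have hi : Integrable (fun ω =>
      Real.exp (expRate b l * ∫ s in Set.Ioi (0 : ℝ), Z s.toNNReal ω)) μ := by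
    refine ⟨hm.aestronglyMeasurable, ?_⟩
    rw [hasFiniteIntegral_iff_ofReal (Eventually.of_forall fun ω => (Real.exp_pos _).le)]
    exact hle.trans_lt ENNReal.ofReal_lt_top
  refine ⟨hi, ?_⟩
  rwa [← ofReal_integral_eq_lintegral_ofReal hi (Eventually.of_forall fun ω => (Real.exp_pos _).le),
    ENNReal.ofReal_le_ofReal_iff (Real.exp_pos _).le] at hle

/-- Lower bound below the critical exponent. The mass of the martingale at time `n` is split
according to the size of `Z n`: the part with `Z n` large is controlled by the exponent `log b`. -/
lemma le_integral_exp_total [IsProbabilityMeasure μ] (hZ : IsProcessZ μ ℱ b Z) (hb : 1 < b)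
    {l : ℝ} (hl : 0 < l) (hlb : l < Real.log b) :
    Real.exp l ≤ ∫ ω, Real.exp (expRate b l * ∫ s in Set.Ioi (0 : ℝ), Z s.toNNReal ω) ∂μ := by
  obtain ⟨hL, hκL⟩ := log_pos_and_expRate_pos hb
  have hκ := expRate_nonneg hb hl.le hlb.le
  have hκκ : expRate b l ≤ expRate b (Real.log b) := expRate_mono hb hlb.le le_rfl
  set L := Real.log b
  set T : Ω → ℝ := fun ω => ∫ s in Set.Ioi (0 : ℝ), Z s.toNNReal ω with hT
  obtain ⟨hTi, -⟩ := hZ.integral_exp_total_le hb hl hκ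
  have hmm : ∀ (K : ℝ) (n : ℕ), Measurable fun ω =>
      Real.exp (expRate b l * T ω + l * min (Z (n : ℝ).toNNReal ω) K) := fun K n =>
    ((hZ.measurable_integral_Ioi.const_mul _).add
      (((hZ.measurable _).min measurable_const).const_mul l)).exp
  have hdom : ∀ (K : ℝ) (n : ℕ) ω,
      ‖Real.exp (expRate b l * T ω + l * min (Z (n : ℝ).toNNReal ω) K)‖ ≤
        Real.exp (expRate b l * T ω) * Real.exp (l * K) := fun K n ω => by
    rw [Real.norm_of_nonneg (Real.exp_pos _).le, Real.exp_add]
    refine mul_le_mul_of_nonneg_left (Real.exp_le_exp.2 ?_) (Real.exp_pos _).le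
    exact mul_le_mul_of_nonneg_left (min_le_right _ _) hl.le
  have hdi : ∀ K, Integrable (fun ω => Real.exp (expRate b l * T ω) * Real.exp (l * K)) μ :=
    fun K => hTi.mul_const _
  have hbound : ∀ (K : ℝ) (n : ℕ), Real.exp l ≤
      (∫ ω, Real.exp (expRate b l * T ω + l * min (Z (n : ℝ).toNNReal ω) K) ∂μ) +
        Real.exp (-(L - l) * K) * Real.exp L := by
    intro K n
    have hn : (0 : ℝ) ≤ n := n.cast_nonneg
    have i1 := (hdi K).mono' (hmm K n).aestronglyMeasurable (Eventually.of_forall (hdom K n))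
    have i2 := (hZ.integrable_exp hb hL hκL.le hn).const_mul (Real.exp (-(L - l) * K))
    calc Real.exp l = ∫ ω, Real.exp (l * Z (n : ℝ).toNNReal ω +
          expRate b l * addFunctional (fun x => x) Z n ω) ∂μ :=
          (hZ.integral_exp_eq hb hl hlb hn).symm
      _ ≤ ∫ ω, (Real.exp (expRate b l * T ω + l * min (Z (n : ℝ).toNNReal ω) K) +
          Real.exp (-(L - l) * K) * Real.exp (L * Z (n : ℝ).toNNReal ω +
            expRate b L * addFunctional (fun x => x) Z n ω)) ∂μ := by
          refine integral_mono_ae (hZ.integrable_exp hb hl hκ hn) (i1.add i2) ?_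
          filter_upwards [hZ.ae_integrableOn hb] with ω hint
          have hI0 : 0 ≤ addFunctional (fun x => x) Z n ω :=
            intervalIntegral.integral_nonneg hn fun r _ => (hZ.pos _ ω).le
          have hIT : addFunctional (fun x => x) Z n ω ≤ T ω := by
            rw [addFunctional, intervalIntegral.integral_of_le hn]
            exact setIntegral_mono_set hint
              (Eventually.of_forall fun s => (hZ.pos _ ω).le)
              (Eventually.of_forall fun s hs => hs.1)
          rcases le_total (Z (n : ℝ).toNNReal ω) K with h | h
          · refine le_add_of_le_of_nonneg (Real.exp_le_exp.2 ?_) (by positivity)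
            rw [min_eq_left h]
            have := mul_le_mul_of_nonneg_left hIT hκ
            linarith
          · refine le_add_of_nonneg_of_le (Real.exp_pos _).le ?_
            rw [← Real.exp_add, Real.exp_le_exp]
            have h1 := mul_le_mul_of_nonneg_right hκκ hI0
            nlinarith
      _ = (∫ ω, Real.exp (expRate b l * T ω + l * min (Z (n : ℝ).toNNReal ω) K) ∂μ) +
          Real.exp (-(L - l) * K) * ∫ ω, Real.exp (L * Z (n : ℝ).toNNReal ω +
            expRate b L * addFunctional (fun x => x) Z n ω) ∂μ := by
          rw [integral_add i1 i2, integral_const_mul]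
      _ ≤ _ := by
          gcongr
          exact hZ.integral_exp_le hb hL hκL.le hn
  have hbound2 : ∀ K : ℝ, 0 ≤ K → Real.exp l ≤ (∫ ω, Real.exp (expRate b l * T ω) ∂μ) +
      Real.exp (-(L - l) * K) * Real.exp L := by
    intro K hK
    refine ge_of_tendsto' (x := atTop) (Tendsto.add_const _ ?_) (hbound K)
    refine tendsto_integral_of_dominated_convergence _
      (fun n => (hmm K n).aestronglyMeasurable) (hdi K)
      (fun n => Eventually.of_forall (hdom K n)) ?_
    filter_upwards [hZ.ae_exp_mul_mono hb, hZ.ae_integrableOn hb] with ω hω hint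
    have h1 := (hZ.tendsto_path_zero hb hω hint).comp (tendsto_natCast_atTop_atTop (R := ℝ))
    have h2 := ((h1.min (tendsto_const_nhds (x := K))).const_mul l).const_add (expRate b l * T ω)
    rw [min_eq_left hK, mul_zero, add_zero] at h2
    exact (Real.continuous_exp.tendsto _).comp h2
  have hlim : Tendsto (fun K : ℝ => (∫ ω, Real.exp (expRate b l * T ω) ∂μ) +
      Real.exp (-(L - l) * K) * Real.exp L) atTop
      (𝓝 ((∫ ω, Real.exp (expRate b l * T ω) ∂μ) + 0 * Real.exp L)) := by
    refine Tendsto.const_add _ (Tendsto.mul_const _ (Real.tendsto_exp_atBot.comp ?_))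
    exact Tendsto.const_mul_atTop_of_neg (by linarith) tendsto_id
  rw [zero_mul, add_zero] at hlim
  refine ge_of_tendsto hlim ?_
  filter_upwards [eventually_ge_atTop 0] with K hK using hbound2 K hK

/-- At the critical exponent the lower bound survives by letting `l` increase to `log b`. -/
theorem integral_exp_total_log [IsProbabilityMeasure μ] (hZ : IsProcessZ μ ℱ b Z) (hb : 1 < b) :
    ∫ ω, Real.exp (expRate b (Real.log b) * ∫ s in Set.Ioi (0 : ℝ), Z s.toNNReal ω) ∂μ = b := by
  obtain ⟨hL, hκL⟩ := log_pos_and_expRate_pos hb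
  obtain ⟨hi, hle⟩ := hZ.integral_exp_total_le hb hL hκL.le
  have hexp : Real.exp (Real.log b) = b := Real.exp_log (by linarith)
  refine le_antisymm (hle.trans_eq hexp) ?_
  have hlim : Tendsto Real.exp (𝓝[<] Real.log b) (𝓝 b) := by
    have := (Real.continuous_exp.tendsto (Real.log b)).mono_left
      (nhdsWithin_le_nhds (s := Set.Iio (Real.log b)))
    rwa [hexp] at this
  refine le_of_tendsto hlim ?_
  filter_upwards [Ioo_mem_nhdsLT hL] with l hl
  have hκ := expRate_nonneg hb hl.1.le hl.2.le
  refine (hZ.le_integral_exp_total hb hl.1 hl.2).trans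
    (integral_mono (hZ.integral_exp_total_le hb hl.1 hκ).1 hi fun ω => Real.exp_le_exp.2 ?_)
  exact mul_le_mul_of_nonneg_right (expRate_mono hb hl.2.le le_rfl)
    (setIntegral_nonneg measurableSet_Ioi fun s _ => (hZ.pos _ ω).le)

end IsProcessZ

theorem lemma4 {Ω : Type*} {m : MeasurableSpace Ω} (μ : Measure Ω) [IsProbabilityMeasure μ]
    (ℱ : Filtration ℝ≥0 m) (b c : ℝ) (hb : 1 < b) (hc : c = Real.log b + b⁻¹ - 1)
    (Z : ℝ≥0 → Ω → ℝ) (hZ : IsProcessZ μ ℱ b Z) :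
    IsSubcriticalCSBP μ ℱ Z ∧
    (∀ᵐ ω ∂μ, Tendsto (fun t => Z t ω) atTop (𝓝 0)) ∧
    0 < c ∧
    (∀ᵐ ω ∂μ, IntegrableOn (fun s : ℝ => Z s.toNNReal ω) (Set.Ioi 0)) ∧
    Integrable (fun ω => Real.exp (c * b * ∫ s in Set.Ioi (0 : ℝ), Z s.toNNReal ω)) μ ∧
    ∫ ω, Real.exp (c * b * ∫ s in Set.Ioi (0 : ℝ), Z s.toNNReal ω) ∂μ = b := by
  obtain ⟨hL, hκ⟩ := log_pos_and_expRate_pos hb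
  have hcb : c * b = expRate b (Real.log b) := by rw [expRate_log hb, hc]
  refine ⟨hZ.isSubcriticalCSBP hb, hZ.ae_tendsto_zero hb, ?_, hZ.ae_integrableOn hb, ?_, ?_⟩
  · rw [← hcb] at hκ
    exact pos_of_mul_pos_left hκ (by linarith)
  · rw [hcb]
    exact (hZ.integral_exp_total_le hb hL hκ.le).1
  · rw [hcb]
    exact hZ.integral_exp_total_log hb
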